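/- Let $n\ge 2$ and let $\Omega\subset\mathbb R^n$ be a bounded open set with $\partial\Omega\in C^2$. Let $\Gamma_1,\Gamma_2$ be disjoint relatively open subsets of $\partial\Omega$ with $\overline{\Gamma}_1\cup\overline{\Gamma}_2=\partial\Omega$, and suppose that near each point of $\widetilde\Gamma:=\overline{\Gamma}_1\cap\overline{\Gamma}_2$ each $\Gamma_i$ has a $C^1$ boundary relative to $\partial\Omega$ (in suitable local coordinates of $\partial\Omega$, $\Gamma_i$ is the region on one side of the graph of a $C^1$ function). Let $\Phi(x,t)=(4\pi t)^{-n/2}e^{-|x|^2/(4t)}$ for $x\in\mathbb R^n$, $t>0$, let $D\Phi$ be its gradient in $x$, let $\vec n(x)$ be the exterior unit normal to $\partial\Omega$ at $x\in\partial\Omega$, and let $dS$ be the surface measure on $\partial\Omega$. Let $T>0$ and let $\varphi:(\Gamma_1\cup\Gamma_2)\times(0,T]\to\mathbb R$ be uniformly continuous on $\Gamma_1\times(0,T]$ and on $\Gamma_2\times(0,T]$ separately. For $i\in\{1,2\}$ let $\varphi_i$ denote the continuous extension of $\varphi|_{\Gamma_i\times(0,T]}$ to $\overline{\Gamma}_i\times[0,T]$.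 Then for $i\in\{1,2\}$, every $x\in\widetilde\Gamma$ and every $t\in(0,T]$, with $x_h:=x-h\,\vec n(x)$, $$\lim_{h\to0^+}\int_0^t\!\!\int_{\Gamma_i}(D\Phi)(x_h-y,t-\tau)\cdot\vec n(x)\,\varphi(y,\tau)\,dS_y\,d\tau=\int_0^t\!\!\int_{\Gamma_i}(D\Phi)(x-y,t-\tau)\cdot\vec n(x)\,\varphi(y,\tau)\,dS_y\,d\tau+\frac14\,\varphi_i(x,t),$$ where the integral on the right, and the integrals on the left for all sufficiently small $h>0$, converge absolutely. -/

import Mathlib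

open MeasureTheory Set Filter Topology

/-- The fundamental solution of the heat equation,
`Φ(x,t) = (4πt)^{-n/2} exp(-|x|²/(4t))` for `x ∈ ℝⁿ`, `t > 0`. -/
noncomputable def heatKernel {n : ℕ} (x : EuclideanSpace ℝ (Fin n)) (t : ℝ) : ℝ :=
  1 / (4 * Real.pi * t) ^ ((n : ℝ) / 2) * Real.exp (-‖x‖ ^ 2 / (4 * t))

/-- `(DΦ)(x,t)`: the gradient of the heat kernel in the space variable. -/
noncomputable def heatKernelGrad {n : ℕ} (x : EuclideanSpace ℝ (Fin n)) (t : ℝ) :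
    EuclideanSpace ℝ (Fin n) :=
  gradient (fun z : EuclideanSpace ℝ (Fin n) => heatKernel z t) x

/-- For a unit vector `e` write `y = y' + s e` with `y' ⟂ e`, `s = ⟪e, y⟫`. This is the function
`y ↦ γ(y') - s`; it vanishes on the graph of `γ` in the direction `e` and is negative above it. -/
noncomputable def graphFun {n : ℕ} (e : EuclideanSpace ℝ (Fin n))
    (γ : EuclideanSpace ℝ (Fin n) → ℝ) (y : EuclideanSpace ℝ (Fin n)) : ℝ :=
  γ (y - inner ℝ e y • e) - inner ℝ e y

/-- In the ball `B(x,r)`, and in orthonormal coordinates with last axis `e`, the set `Ω` is the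
region above the graph of the `C²` function `γ` of the other coordinates. -/
structure IsC2GraphNear {n : ℕ} (Ω : Set (EuclideanSpace ℝ (Fin n)))
    (x : EuclideanSpace ℝ (Fin n)) (r : ℝ) (e : EuclideanSpace ℝ (Fin n))
    (γ : EuclideanSpace ℝ (Fin n) → ℝ) : Prop where
  radius_pos : 0 < r
  norm_axis : ‖e‖ = 1
  contDiff : ContDiff ℝ 2 γ
  mem_iff : ∀ y ∈ Metric.ball x r, y ∈ Ω ↔ graphFun e γ y < 0

/-- `∂Ω ∈ C²`: near each boundary point, `Ω` lies above the graph of a `C²` function, after a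
rigid change of coordinates. -/
def HasC2Boundary {n : ℕ} (Ω : Set (EuclideanSpace ℝ (Fin n))) : Prop :=
  ∀ x ∈ frontier Ω, ∃ r e γ, IsC2GraphNear Ω x r e γ

/-- `ν` is the exterior unit normal vector of `∂Ω` at `x`: the normalized gradient at `x` of a
local graph function of `Ω`, which is negative inside `Ω` and vanishes on `∂Ω`. -/
def IsExteriorUnitNormal {n : ℕ} (Ω : Set (EuclideanSpace ℝ (Fin n)))
    (x ν : EuclideanSpace ℝ (Fin n)) : Prop :=
  ∃ r e γ, IsC2GraphNear Ω x r e γ ∧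
    ν = ‖gradient (graphFun e γ) x‖⁻¹ • gradient (graphFun e γ) x

/-- The subset `S` of the hypersurface `∂Ω` has a `C¹` boundary near `x`: in a local graph chart
of `∂Ω` with axis `e`, and in orthonormal coordinates of the chart domain `e^⟂` with last axis
`a`, the set `S` is the region above the graph of a `C¹` function `σ` of the remaining `n - 2`
coordinates. -/
def HasC1RelBoundaryAt {n : ℕ} (Ω S : Set (EuclideanSpace ℝ (Fin n)))
    (x : EuclideanSpace ℝ (Fin n)) : Prop :=
  ∃ (r : ℝ) (e : EuclideanSpace ℝ (Fin n)) (γ : EuclideanSpace ℝ (Fin n) → ℝ)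
    (a : EuclideanSpace ℝ (Fin n)) (σ : EuclideanSpace ℝ (Fin n) → ℝ),
    IsC2GraphNear Ω x r e γ ∧ ‖a‖ = 1 ∧ inner ℝ e a = 0 ∧ ContDiff ℝ 1 σ ∧
    ∀ y ∈ frontier Ω ∩ Metric.ball x r,
      y ∈ S ↔ σ (y - inner ℝ e y • e - inner ℝ a y • a) < inner ℝ a y

/-- Membership in `𝓑_T`: `φ` is uniformly continuous on each `Γᵢ × (0,T]` separately. Only the
values on `(Γ₁ ∪ Γ₂) × (0,T]` matter. -/
def MemBT {n : ℕ} (Γ : Fin 2 → Set (EuclideanSpace ℝ (Fin n))) (T : ℝ)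
    (φ : EuclideanSpace ℝ (Fin n) × ℝ → ℝ) : Prop :=
  ∀ i, UniformContinuousOn φ (Γ i ×ˢ Ioc 0 T)

/-- The continuous extension `φᵢ` of `φ|_{S × (0,T]}` to `closure S × [0,T]`, given by limits
along `S × (0,T]`. -/
noncomputable def closureExtension {n : ℕ} (S : Set (EuclideanSpace ℝ (Fin n))) (T : ℝ)
    (φ : EuclideanSpace ℝ (Fin n) × ℝ → ℝ) : EuclideanSpace ℝ (Fin n) × ℝ → ℝ :=
  extendFrom (S ×ˢ Ioc 0 T) φ

/-- The integrand `(DΦ)(z - y, t - τ) · ν φ(y,τ)`. -/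
noncomputable def potentialIntegrand {n : ℕ} (φ : EuclideanSpace ℝ (Fin n) × ℝ → ℝ)
    (ν z : EuclideanSpace ℝ (Fin n)) (t : ℝ) (p : EuclideanSpace ℝ (Fin n) × ℝ) : ℝ :=
  inner ℝ (heatKernelGrad (z - p.1) (t - p.2)) ν * φ p

/-- `∫₀ᵗ ∫_S (DΦ)(z - y, t - τ) · ν φ(y,τ) dS_y dτ`, where `dS` is the surface measure, that is,
the `(n-1)`-dimensional Hausdorff measure in its Euclidean normalization. -/
noncomputable def normalDerivPotential {n : ℕ} (S : Set (EuclideanSpace ℝ (Fin n)))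
    (φ : EuclideanSpace ℝ (Fin n) × ℝ → ℝ) (ν z : EuclideanSpace ℝ (Fin n)) (t : ℝ) : ℝ :=
  ∫ τ in (0 : ℝ)..t, ∫ y in S, potentialIntegrand φ ν z t (y, τ) ∂μHE[n - 1]

/-- The integral defining `normalDerivPotential S φ ν z t` converges absolutely on
`S × (0,t)`. -/
def PotentialConverges {n : ℕ} (S : Set (EuclideanSpace ℝ (Fin n)))
    (φ : EuclideanSpace ℝ (Fin n) × ℝ → ℝ) (ν z : EuclideanSpace ℝ (Fin n)) (t : ℝ) : Prop :=
  Integrable (potentialIntegrand φ ν z t)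
    (((μHE[n - 1] : Measure (EuclideanSpace ℝ (Fin n))).restrict S).prod
      ((volume : Measure ℝ).restrict (Ioc 0 t)))

/-! With `s = t - τ`, one has `DΦ(z,s) · ν = -⟨z,ν⟩ (2s)⁻¹ Φ(z,s)` and `-⟨x - hν - y, ν⟩ = h + ⟨y -
x, ν⟩`. So the integrand splits (`potentialIntegrand_eq`) into a layer term with factor `h` and a
residual term with factor `⟨y - x, ν⟩`.

Residual term: a `C²` surface leaves its tangent plane only quadratically
(`IsSurfaceChart.exists_abs_inner_le`), which compensates the factor `1/s`. For small `h ≥ 0` the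
squared distance from `x - hν` to `y` is at least `|y-x|²/2 + h²` (`half_sq_add_sq_le`), so one
dominating function serves all these `h`; its surface integral is `O((t-τ)^(-1/2))`. Dominated
convergence (`tendsto_integral_residual`) gives the value at `h = 0`, which is the whole integral at
`x`, because the layer term vanishes there.

Layer term: away from `x` it is `O(h)`. Near `x` the surface is parametrized over its tangent plane
and rescaled by `u = hw`, `s = h²σ` (`tendsto_integral_layer`). The Jacobians and the prefactor `h`
are absorbed exactly by the homogeneity of the kernel (`heatWeight_scale`). In the limit the surface
density becomes `1` (`exists_surface_density`), the rescaled squared distance becomes `|w|² + 1`,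
the region `Γᵢ` becomes a half-space (`IsSurfaceChart.exists_halfSpace`), and `φ` becomes the
constant `φᵢ(x,t)`. The half-space Gaussian contributes `1/2` and the remaining time integral
another `1/2` (`integral_Ioi_heatWeight_one`), whence the factor `1/4`. -/

/-! ### The scalar kernel: monotonicity, parabolic homogeneity, factorization. -/

/-- The radial profile `(2s)⁻¹ Φ` of the gradient of the heat kernel, as a function of the squared
distance `q` and of the time `s`. -/
noncomputable def heatWeight (n : ℕ) (q s : ℝ) : ℝ :=
  (2 * s)⁻¹ * (1 / (4 * Real.pi * s) ^ ((n : ℝ) / 2) * Real.exp (-q / (4 * s)))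

lemma heatWeight_nonneg (n : ℕ) (q : ℝ) {s : ℝ} (hs : 0 < s) : 0 ≤ heatWeight n q s := by
  unfold heatWeight; positivity

lemma heatWeight_anti (n : ℕ) {q q' s : ℝ} (hs : 0 < s) (h : q ≤ q') :
    heatWeight n q' s ≤ heatWeight n q s := by
  unfold heatWeight
  gcongr

lemma measurable_heatWeight (n : ℕ) : Measurable (fun p : ℝ × ℝ => heatWeight n p.1 p.2) := by
  unfold heatWeight
  fun_prop

/-- The three factors are the Jacobians of `s ↦ h²s` and `u ↦ hu` in dimension `d`, and the
prefactor of the layer term; together they match the degree `-(d+3)` of the kernel. -/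
lemma heatWeight_scale {d : ℕ} {h s : ℝ} (hh : 0 < h) (hs : 0 < s) (q : ℝ) :
    h ^ 2 * (h ^ d * (h * heatWeight (d + 1) q (h ^ 2 * s))) = heatWeight (d + 1) (q / h ^ 2) s := by
  unfold heatWeight
  have h1 : (4 * Real.pi * (h ^ 2 * s)) ^ (((d + 1 : ℕ) : ℝ) / 2)
      = h ^ (d + 1) * (4 * Real.pi * s) ^ (((d + 1 : ℕ) : ℝ) / 2) := by
    rw [show 4 * Real.pi * (h ^ 2 * s) = h ^ 2 * (4 * Real.pi * s) by ring,
      Real.mul_rpow (by positivity) (by positivity), ← Real.rpow_natCast h 2, ← Real.rpow_mul hh.le,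
      ← Real.rpow_natCast h (d + 1)]
    congr 2
    push_cast
    ring
  have h2 : -q / (4 * (h ^ 2 * s)) = -(q / h ^ 2) / (4 * s) := by field_simp
  have h3 : 0 < (4 * Real.pi * s) ^ (((d + 1 : ℕ) : ℝ) / 2) := by positivity
  rw [h1, h2]
  field_simp
  ring

/-- Separates the normal variable from the `d` tangential ones, so that the tangential Gaussian can
be integrated first. -/
lemma heatWeight_succ (d : ℕ) (a b : ℝ) {s : ℝ} (hs : 0 < s) :
    heatWeight (d + 1) (a + b) s
      = heatWeight 1 b s * (1 / (4 * Real.pi * s) ^ ((d : ℝ) / 2) * Real.exp (-a / (4 * s))) := by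
  unfold heatWeight
  have h1 : (4 * Real.pi * s) ^ (((d + 1 : ℕ) : ℝ) / 2)
      = (4 * Real.pi * s) ^ ((d : ℝ) / 2) * (4 * Real.pi * s) ^ (((1 : ℕ) : ℝ) / 2) := by
    rw [← Real.rpow_add (by positivity)]
    congr 1
    push_cast
    ring
  have h2 : Real.exp (-(a + b) / (4 * s)) = Real.exp (-a / (4 * s)) * Real.exp (-b / (4 * s)) := by
    rw [← Real.exp_add]
    congr 1
    ring
  rw [h1, h2]
  field_simp

/-! ### Gaussian integrals and the parabolic blow-up. -/

section Gaussian

variable {V : Type*} [NormedAddCommGroup V] [InnerProductSpace ℝ V] [FiniteDimensional ℝ V]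
  [MeasurableSpace V] [BorelSpace V]

lemma integral_exp_neg_sq_div {s a : ℝ} (hs : 0 < s) (ha : 0 < a) :
    ∫ v : V, Real.exp (-(a * ‖v‖ ^ 2) / (4 * s))
      = (4 * Real.pi * s / a) ^ ((Module.finrank ℝ V : ℝ) / 2) := by
  have hb : 0 < a / (4 * s) := by positivity
  have := GaussianFourier.integral_rexp_neg_mul_sq_norm (V := V) hb
  convert this using 2
  · ext v
    congr 1
    ring
  · field_simp

/-- The Bochner integral of a non-integrable function is `0` by convention, so a nonzero value
forces integrability. -/
lemma integrable_exp_neg_sq_div {s a : ℝ} (hs : 0 < s) (ha : 0 < a) :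
    Integrable (fun v : V => Real.exp (-(a * ‖v‖ ^ 2) / (4 * s))) := by
  by_contra h
  have h1 := integral_exp_neg_sq_div (V := V) hs ha
  rw [integral_undef h] at h1
  have : 0 < (4 * Real.pi * s / a) ^ ((Module.finrank ℝ V : ℝ) / 2) := by positivity
  linarith

/-- The substitution `s = x⁻²` turns the integrand into a multiple of `exp(-x²/4)`. -/
lemma integral_Ioi_heatWeight_one :
    ∫ s in Ioi (0 : ℝ), heatWeight 1 1 s = 1 / 2 := by
  rw [← integral_comp_rpow_Ioi (fun s => heatWeight 1 1 s) (p := -2) (by norm_num)]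
  have : ∀ x ∈ Ioi (0 : ℝ), (|(-2 : ℝ)| * x ^ ((-2 : ℝ) - 1)) • heatWeight 1 1 (x ^ (-2 : ℝ))
      = (1 / (2 * √Real.pi)) * Real.exp (-(1 / 4) * x ^ 2) := by
    intro x hx
    have hx : 0 < x := hx
    unfold heatWeight
    have e1 : x ^ (-2 : ℝ) = (x ^ 2)⁻¹ := by
      rw [Real.rpow_neg hx.le]; norm_cast
    have e2 : x ^ ((-2 : ℝ) - 1) = (x ^ 3)⁻¹ := by
      rw [show (-2 : ℝ) - 1 = -3 by norm_num, Real.rpow_neg hx.le]; norm_cast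
    have e3 : (4 * Real.pi * (x ^ 2)⁻¹) ^ (((1 : ℕ) : ℝ) / 2) = 2 * √Real.pi / x := by
      rw [show (((1 : ℕ) : ℝ) / 2) = 1 / 2 by norm_num, ← Real.sqrt_eq_rpow,
        show 4 * Real.pi * (x ^ 2)⁻¹ = (2 / x) ^ 2 * Real.pi by field_simp; norm_num,
        Real.sqrt_mul (by positivity), Real.sqrt_sq (by positivity)]
      ring
    have e4 : -1 / (4 * (x ^ 2)⁻¹) = -(1 / 4) * x ^ 2 := by field_simp
    rw [e1, e2, e3, e4]
    have : 0 < √Real.pi := Real.sqrt_pos.2 Real.pi_pos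
    simp only [smul_eq_mul]
    norm_num
    field_simp
  rw [setIntegral_congr_fun measurableSet_Ioi this, integral_const_mul, integral_gaussian_Ioi]
  rw [show Real.pi / (1 / 4) = 2 ^ 2 * Real.pi by ring, Real.sqrt_mul (by positivity),
    Real.sqrt_sq (by positivity)]
  have : 0 < √Real.pi := Real.sqrt_pos.2 Real.pi_pos
  field_simp

lemma integrableOn_heatWeight_one : IntegrableOn (fun s => heatWeight 1 1 s) (Ioi 0) := by
  by_contra h
  have h1 := integral_Ioi_heatWeight_one
  rw [integral_undef h] at h1
  norm_num at h1

-- The dominating function of the blow-up. Its tangential Gaussian integrates to a constant multiple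
-- of `(4πs)^(d/2)`, which cancels the normalization and leaves the integrable `heatWeight 1 1`.
variable (V) in
lemma integrable_heatWeight_prod {d : ℕ} (hd : Module.finrank ℝ V = d) {a : ℝ} (ha : 0 < a) :
    Integrable (fun p : ℝ × V => heatWeight (d + 1) (a * ‖p.2‖ ^ 2 + 1) p.1)
      (((volume : Measure ℝ).restrict (Ioi 0)).prod (volume : Measure V)) := by
  have hm : Measurable (fun p : ℝ × V => heatWeight (d + 1) (a * ‖p.2‖ ^ 2 + 1) p.1) :=
    (measurable_heatWeight (d + 1)).comp (by fun_prop : Measurable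
      (fun p : ℝ × V => (a * ‖p.2‖ ^ 2 + 1, p.1)))
  have hpt : ∀ s ∈ Ioi (0 : ℝ), ∀ v : V, heatWeight (d + 1) (a * ‖v‖ ^ 2 + 1) s
      = heatWeight 1 1 s * (1 / (4 * Real.pi * s) ^ ((d : ℝ) / 2))
        * Real.exp (-(a * ‖v‖ ^ 2) / (4 * s)) := by
    intro s hs v
    rw [heatWeight_succ _ _ _ hs]
    ring
  rw [integrable_prod_iff hm.aestronglyMeasurable]
  constructor
  · filter_upwards [ae_restrict_mem measurableSet_Ioi] with s hs
    simp only [hpt s hs]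
    exact (integrable_exp_neg_sq_div hs ha).const_mul _
  · have : ∀ s ∈ Ioi (0 : ℝ), ∫ v : V, ‖heatWeight (d + 1) (a * ‖v‖ ^ 2 + 1) s‖
        = (1 / a ^ ((d : ℝ) / 2)) * heatWeight 1 1 s := by
      intro s hs
      have hs' : 0 < s := hs
      have h1 : ∀ v : V, ‖heatWeight (d + 1) (a * ‖v‖ ^ 2 + 1) s‖ = _ := fun v =>
        (Real.norm_of_nonneg (heatWeight_nonneg _ _ hs')).trans (hpt s hs v)
      simp only [h1]
      rw [integral_const_mul, integral_exp_neg_sq_div hs' ha, hd,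
        Real.div_rpow (by positivity) ha.le]
      field_simp
    exact IntegrableOn.congr_fun (Integrable.const_mul integrableOn_heatWeight_one _)
      (fun s hs => (this s hs).symm) measurableSet_Ioi

lemma ae_apply_ne_zero {ℓ : V →L[ℝ] ℝ} (hℓ : ℓ ≠ 0) : ∀ᵐ v : V, ℓ v ≠ 0 := by
  have := Measure.addHaar_submodule (volume : Measure V) (LinearMap.ker (ℓ : V →ₗ[ℝ] ℝ)) (by
    intro h
    apply hℓ
    ext v
    have : v ∈ LinearMap.ker (ℓ : V →ₗ[ℝ] ℝ) := h ▸ Submodule.mem_top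
    simpa using this)
  rw [ae_iff]
  convert this using 2
  ext v
  simp

/-- The reflection `v ↦ -v` exchanges the two half-spaces, and the hyperplane between them is null.
-/
lemma integral_halfSpace_exp_neg_sq_div {ℓ : V →L[ℝ] ℝ} (hℓ : ℓ ≠ 0) {s : ℝ} (hs : 0 < s) :
    ∫ v in {v | 0 < ℓ v}, Real.exp (-‖v‖ ^ 2 / (4 * s))
      = (4 * Real.pi * s) ^ ((Module.finrank ℝ V : ℝ) / 2) / 2 := by
  have hint : Integrable (fun v : V => Real.exp (-‖v‖ ^ 2 / (4 * s))) := by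
    simpa using integrable_exp_neg_sq_div (V := V) hs one_pos
  have htot : ∫ v : V, Real.exp (-‖v‖ ^ 2 / (4 * s))
      = (4 * Real.pi * s) ^ ((Module.finrank ℝ V : ℝ) / 2) := by
    simpa using integral_exp_neg_sq_div (V := V) hs one_pos
  have hmeas : MeasurableSet {v | 0 < ℓ v} := measurableSet_lt measurable_const ℓ.measurable
  have hmeas' : MeasurableSet {v | ℓ v < 0} := measurableSet_lt ℓ.measurable measurable_const
  have hneg : ∫ v in {v | ℓ v < 0}, Real.exp (-‖v‖ ^ 2 / (4 * s))
      = ∫ v in {v | 0 < ℓ v}, Real.exp (-‖v‖ ^ 2 / (4 * s)) := by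
    rw [← integral_indicator hmeas, ← integral_indicator hmeas', ← integral_neg_eq_self]
    congr 1
    ext v
    simp [indicator]
  have hcompl : ∫ v in {v | 0 < ℓ v}ᶜ, Real.exp (-‖v‖ ^ 2 / (4 * s))
      = ∫ v in {v | ℓ v < 0}, Real.exp (-‖v‖ ^ 2 / (4 * s)) := by
    apply setIntegral_congr_set
    filter_upwards [ae_apply_ne_zero hℓ] with v hv
    apply propext
    change (¬ (0 < ℓ v)) ↔ ℓ v < 0
    grind
  have := integral_add_compl hmeas hint
  rw [hcompl, hneg, htot] at this
  linarith

/-- Parabolic blow-up: the layer kernel `h (2s)⁻¹ Φ` over a perturbation of a half-hyperplane has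
mass tending to `1/4`, concentrated at the origin. -/
lemma tendsto_integral_layer {d : ℕ} (hd : Module.finrank ℝ V = d) {Ψ : V → ℝ → ℝ}
    (hΨm : Measurable (Function.uncurry Ψ)) {M : ℝ} (hΨb : ∀ u s, |Ψ u s| ≤ M)
    {r : ℝ → V → ℝ} (hrm : ∀ h, Measurable (r h)) {h₀ a : ℝ} (hh₀ : 0 < h₀) (ha : 0 < a)
    (hlow : ∀ h ∈ Ioo 0 h₀, ∀ u s, Ψ u s ≠ 0 → a * ‖u‖ ^ 2 + h ^ 2 ≤ r h u)
    (hlim : ∀ w, Tendsto (fun h => r h (h • w) / h ^ 2) (𝓝[>] 0) (𝓝 (‖w‖ ^ 2 + 1)))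
    {ℓ : V →L[ℝ] ℝ} (hℓ : ℓ ≠ 0) {c : ℝ}
    (hΨlim : ∀ w, ℓ w ≠ 0 → ∀ s, 0 < s →
      Tendsto (fun h => Ψ (h • w) (h ^ 2 * s)) (𝓝[>] 0) (𝓝 ({w | 0 < ℓ w}.indicator (fun _ => c) w))) :
    Tendsto (fun h => ∫ s in Ioi 0, ∫ u, h * heatWeight (d + 1) (r h u) s * Ψ u s) (𝓝[>] 0)
      (𝓝 (c / 4)) := by
  set μ := ((volume : Measure ℝ).restrict (Ioi 0)).prod (volume : Measure V)
  have hΨm' : Measurable (fun p : V × ℝ => Ψ p.1 p.2) := hΨm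
  have hM : 0 ≤ M := (abs_nonneg _).trans (hΨb 0 0)
  have hpos : ∀ᵐ p : ℝ × V ∂μ, 0 < p.1 := by
    have : ∀ᵐ s ∂(volume : Measure ℝ).restrict (Ioi 0), 0 < s := ae_restrict_mem measurableSet_Ioi
    exact Measure.quasiMeasurePreserving_fst.ae this
  have hker : ∀ᵐ p : ℝ × V ∂μ, ℓ p.2 ≠ 0 :=
    Measure.quasiMeasurePreserving_snd.ae (ae_apply_ne_zero hℓ)
  set G : ℝ → ℝ × V → ℝ := fun h p =>
    heatWeight (d + 1) (r h (h • p.2) / h ^ 2) p.1 * Ψ (h • p.2) (h ^ 2 * p.1) with hG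
  have hGm : ∀ h, Measurable (G h) := by
    intro h
    have h1 : Measurable (fun p : ℝ × V => (r h (h • p.2) / h ^ 2, p.1)) :=
      (((hrm h).comp (measurable_snd.const_smul h)).div_const _).prodMk measurable_fst
    have h2 : Measurable (fun p : ℝ × V => (h • p.2, h ^ 2 * p.1)) :=
      (measurable_snd.const_smul h).prodMk (measurable_fst.const_mul _)
    exact ((measurable_heatWeight (d + 1)).comp h1).mul (hΨm'.comp h2)
  set D : ℝ × V → ℝ := fun p => M * heatWeight (d + 1) (a * ‖p.2‖ ^ 2 + 1) p.1 with hDdef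
  have hD : Integrable D μ := (integrable_heatWeight_prod V hd ha).const_mul M
  have hev : ∀ᶠ h in 𝓝[>] (0 : ℝ), h ∈ Ioo 0 h₀ := Ioo_mem_nhdsGT hh₀
  have hbound : ∀ h ∈ Ioo 0 h₀, ∀ p : ℝ × V, 0 < p.1 → ‖G h p‖ ≤ D p := by
    intro h hh p hp
    have hh0 : 0 < h := hh.1
    -- The lower bound on `r` is available only on the support of `Ψ`, which is all that matters.
    by_cases hz : Ψ (h • p.2) (h ^ 2 * p.1) = 0
    · simp only [hG, hz, mul_zero, norm_zero]
      exact mul_nonneg hM (heatWeight_nonneg _ _ hp)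
    · have h1 := hlow h hh _ _ hz
      have h2 : a * ‖p.2‖ ^ 2 + 1 ≤ r h (h • p.2) / h ^ 2 := by
        rw [le_div_iff₀ (by positivity)]
        rw [norm_smul, Real.norm_of_nonneg hh0.le] at h1
        linarith
      simp only [hG, hDdef, norm_mul, Real.norm_eq_abs, abs_of_nonneg (heatWeight_nonneg _ _ hp)]
      rw [mul_comm]
      exact mul_le_mul (hΨb _ _) (heatWeight_anti _ hp h2) (heatWeight_nonneg _ _ hp) hM
  have hGint : ∀ h ∈ Ioo 0 h₀, Integrable (G h) μ := by
    intro h hh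
    refine hD.mono' (hGm h).aestronglyMeasurable ?_
    filter_upwards [hpos] with p hp using hbound h hh p hp
  set G₀ : ℝ × V → ℝ := fun p =>
    heatWeight (d + 1) (‖p.2‖ ^ 2 + 1) p.1 * {w | 0 < ℓ w}.indicator (fun _ => c) p.2 with hG₀
  have hdct : Tendsto (fun h => ∫ p, G h p ∂μ) (𝓝[>] 0) (𝓝 (∫ p, G₀ p ∂μ)) := by
    refine tendsto_integral_filter_of_dominated_convergence D
      (Eventually.of_forall fun h => (hGm h).aestronglyMeasurable) ?_ hD ?_
    · filter_upwards [hev] with h hh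
      filter_upwards [hpos] with p hp using hbound h hh p hp
    · filter_upwards [hpos, hker] with p hp hℓp
      refine Tendsto.mul ?_ (hΨlim p.2 hℓp p.1 hp)
      have hc : Continuous (fun q => heatWeight (d + 1) q p.1) := by
        unfold heatWeight
        fun_prop
      exact (hc.tendsto _).comp (hlim p.2)
  -- Change of variables `s ↦ h²s`, `u ↦ hw`.
  have hscale : ∀ h ∈ Ioo 0 h₀,
      ∫ s in Ioi 0, ∫ u, h * heatWeight (d + 1) (r h u) s * Ψ u s = ∫ p, G h p ∂μ := by
    intro h hh
    have hh0 : 0 < h := hh.1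
    rw [integral_prod _ (hGint h hh)]
    have h2 := integral_comp_mul_left_Ioi
      (fun s => ∫ u, h * heatWeight (d + 1) (r h u) s * Ψ u s) 0 (b := h ^ 2) (by positivity)
    rw [mul_zero] at h2
    have h3 : ∫ s in Ioi 0, ∫ u, h * heatWeight (d + 1) (r h u) s * Ψ u s
        = h ^ 2 * ∫ s in Ioi 0, ∫ u, h * heatWeight (d + 1) (r h u) (h ^ 2 * s) * Ψ u (h ^ 2 * s) := by
      rw [h2, smul_eq_mul]
      field_simp
    rw [h3, ← integral_const_mul]
    refine setIntegral_congr_fun measurableSet_Ioi fun s hs => ?_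
    have h4 := Measure.integral_comp_smul (volume : Measure V)
      (fun u => h * heatWeight (d + 1) (r h u) (h ^ 2 * s) * Ψ u (h ^ 2 * s)) h
    rw [hd, abs_of_nonneg (by positivity), smul_eq_mul] at h4
    have h5 : ∫ u, h * heatWeight (d + 1) (r h u) (h ^ 2 * s) * Ψ u (h ^ 2 * s)
        = h ^ d * ∫ w : V, h * heatWeight (d + 1) (r h (h • w)) (h ^ 2 * s)
          * Ψ (h • w) (h ^ 2 * s) := by
      rw [h4]
      field_simp
    simp only [hG]
    rw [h5, ← integral_const_mul, ← integral_const_mul]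
    congr 1
    ext w
    rw [← heatWeight_scale hh0 hs]
    ring
  have hval : ∫ p, G₀ p ∂μ = c / 4 := by
    have hG₀int : Integrable G₀ μ := by
      have h1 := (integrable_heatWeight_prod V hd one_pos).mul_const |c|
      refine h1.mono' ?_ ?_
      · apply Measurable.aestronglyMeasurable
        apply Measurable.mul
        · exact (measurable_heatWeight (d + 1)).comp (by fun_prop : Measurable
            (fun p : ℝ × V => (‖p.2‖ ^ 2 + 1, p.1)))
        · exact (measurable_const.indicator
            (measurableSet_lt measurable_const ℓ.measurable)).comp measurable_snd
      · filter_upwards [hpos] with p hp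
        simp only [hG₀, norm_mul, Real.norm_eq_abs, abs_of_nonneg (heatWeight_nonneg _ _ hp), one_mul]
        refine mul_le_mul_of_nonneg_left ?_ (heatWeight_nonneg _ _ hp)
        by_cases hz : 0 < ℓ p.2 <;> simp [indicator, hz]
    rw [integral_prod _ hG₀int]
    -- The half-space supplies one factor `1/2`; the time integral of `heatWeight 1 1` supplies the
    -- other.
    have : ∀ s ∈ Ioi (0 : ℝ), ∫ v : V, G₀ (s, v) = heatWeight 1 1 s * (c / 2) := by
      intro s hs
      have hs' : 0 < s := hs
      have h1 : ∀ v : V, G₀ (s, v) = (heatWeight 1 1 s * (1 / (4 * Real.pi * s) ^ ((d : ℝ) / 2)) * c)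
          * {w | 0 < ℓ w}.indicator (fun v => Real.exp (-‖v‖ ^ 2 / (4 * s))) v := by
        intro v
        simp only [hG₀, heatWeight_succ _ _ _ hs']
        by_cases hz : 0 < ℓ v
        · simp only [indicator, mem_ofPred_eq, hz, if_true]
          ring
        · simp [indicator, hz]
      simp only [h1]
      rw [integral_const_mul, integral_indicator (measurableSet_lt measurable_const ℓ.measurable),
        integral_halfSpace_exp_neg_sq_div hℓ hs', hd]
      have : 0 < (4 * Real.pi * s) ^ ((d : ℝ) / 2) := by positivity
      field_simp
    rw [setIntegral_congr_fun measurableSet_Ioi this, integral_mul_const,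
      integral_Ioi_heatWeight_one]
    ring
  rw [← hval]
  refine hdct.congr' ?_
  filter_upwards [hev] with h hh using (hscale h hh).symm

end Gaussian

/-! ### Hausdorff measure on almost isometric images. -/

section Density

open scoped NNReal ENNReal

lemma toNNReal_le_of_le_coe {a : ℝ≥0∞} {c : ℝ≥0} (h : a ≤ c) : a.toNNReal ≤ c := by
  simpa using ENNReal.toNNReal_mono ENNReal.coe_ne_top h

lemma ae_le_const_of_measure_le {V : Type*} [MeasurableSpace V] {μ ν : Measure V} [SigmaFinite μ]
    {f : V → ℝ≥0∞} (hf : Measurable f) (hν : ν = μ.withDensity f) {s : Set V}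
    (hs : MeasurableSet s) {c : ℝ≥0∞} (h : ∀ B ⊆ s, MeasurableSet B → ν B ≤ c * μ B) :
    ∀ᵐ v ∂μ, v ∈ s → f v ≤ c := by
  rw [← ae_restrict_iff' hs]
  refine ae_le_of_forall_setLIntegral_le_of_sigmaFinite (g := fun _ => c) hf fun B hB _ => ?_
  rw [Measure.restrict_restrict hB, setLIntegral_const, ← withDensity_apply _ (hB.inter hs), ← hν]
  exact h _ inter_subset_right (hB.inter hs)

lemma ae_const_le_of_measure_le {V : Type*} [MeasurableSpace V] {μ ν : Measure V} [SigmaFinite μ]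
    {f : V → ℝ≥0∞} (hν : ν = μ.withDensity f) {s : Set V}
    (hs : MeasurableSet s) {c : ℝ≥0∞} (h : ∀ B ⊆ s, MeasurableSet B → c * μ B ≤ ν B) :
    ∀ᵐ v ∂μ, v ∈ s → c ≤ f v := by
  rw [← ae_restrict_iff' hs]
  refine ae_le_of_forall_setLIntegral_le_of_sigmaFinite (f := fun _ => c) measurable_const
    fun B hB _ => ?_
  rw [Measure.restrict_restrict hB, setLIntegral_const, ← withDensity_apply _ (hB.inter hs), ← hν]
  exact h _ inter_subset_right (hB.inter hs)

/-- A measure which is comparable to `μ` with constants tending to `1` at `x` has a bounded density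
which tends to `1` at `x`. -/
lemma exists_density_tendsto_one {V : Type*} [PseudoMetricSpace V] [MeasurableSpace V]
    [BorelSpace V] {μ ν : Measure V} [SigmaFinite μ] [SigmaFinite ν] {x : V} {C : ℝ≥0} (hC : 1 ≤ C)
    (hle : ∀ B, MeasurableSet B → ν B ≤ C * μ B)
    (hloc : ∀ c : ℝ≥0, 1 < c → ∃ ρ > 0, ∀ B ⊆ Metric.ball x ρ, MeasurableSet B →
      ν B ≤ c * μ B ∧ (c : ℝ≥0∞)⁻¹ * μ B ≤ ν B) :
    ∃ θ : V → ℝ≥0, Measurable θ ∧ (∀ v, θ v ≤ C) ∧ Tendsto θ (𝓝 x) (𝓝 1) ∧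
      ν = μ.withDensity (fun v => θ v) := by
  have hac : ν ≪ μ := by
    refine Measure.AbsolutelyContinuous.mk fun B hB h0 => ?_
    simpa [h0] using hle B hB
  set f := ν.rnDeriv μ with hf
  have hfm : Measurable f := Measure.measurable_rnDeriv _ _
  have hνf : ν = μ.withDensity f := (Measure.withDensity_rnDeriv_eq ν μ hac).symm
  obtain ⟨c, -, hc1, hclim⟩ := exists_seq_strictAnti_tendsto (1 : ℝ≥0)
  choose ρ hρ hB using fun k => hloc (c k) (hc1 k)
  -- The Radon–Nikodym derivative obeys the bounds only almost everywhere. Countably many constants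
  -- `c k ↓ 1` suffice, so all bounds hold on one conull set `G`; resetting the density to `1` off
  -- `G` makes them hold at every point, as a genuine limit at `x` requires.
  set G : Set V := {v | f v ≤ C} ∩ ⋂ k, ({v | v ∈ Metric.ball x (ρ k) → f v ≤ c k} ∩
    {v | v ∈ Metric.ball x (ρ k) → (c k : ℝ≥0∞)⁻¹ ≤ f v}) with hG
  have hGm : MeasurableSet G := by
    have hb : ∀ k, MeasurableSet (Metric.ball x (ρ k)) := fun k => Metric.isOpen_ball.measurableSet
    refine (measurableSet_le hfm measurable_const).inter (MeasurableSet.iInter fun k => ?_)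
    exact ((hb k).himp (measurableSet_le hfm measurable_const)).inter
      ((hb k).himp (measurableSet_le measurable_const hfm))
  have hGae : ∀ᵐ v ∂μ, v ∈ G := by
    have h1 := ae_le_const_of_measure_le hfm hνf MeasurableSet.univ (c := C)
      (fun B _ hB => hle B hB)
    have h2 := fun k => ae_le_const_of_measure_le hfm hνf (Metric.isOpen_ball.measurableSet)
      (fun B hs hBm => (hB k B hs hBm).1)
    have h3 := fun k => ae_const_le_of_measure_le hνf (Metric.isOpen_ball.measurableSet)
      (fun B hs hBm => (hB k B hs hBm).2)
    filter_upwards [h1, ae_all_iff.2 h2, ae_all_iff.2 h3] with v a1 a2 a3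
    exact ⟨a1 (mem_univ _), mem_iInter.2 fun k => ⟨a2 k, a3 k⟩⟩
  classical
  refine ⟨fun v => if v ∈ G then (f v).toNNReal else 1, ?_, ?_, ?_, ?_⟩
  · exact Measurable.ite hGm hfm.ennreal_toNNReal measurable_const
  · intro v
    by_cases hv : v ∈ G
    · simp only [hv, if_true]
      exact (toNNReal_le_of_le_coe hv.1)
    · simpa only [hv, if_false] using hC
  · have key : ∀ k, ∀ v ∈ Metric.ball x (ρ k),
        (if v ∈ G then (f v).toNNReal else 1) ∈ Icc (c k)⁻¹ (c k) := by
      intro k v hv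
      have hck : c k ≠ 0 := (zero_lt_one.trans (hc1 k)).ne'
      by_cases hvG : v ∈ G
      · simp only [hvG, if_true]
        have h := mem_iInter.1 hvG.2 k
        have hfin : f v ≠ ∞ := ne_top_of_le_ne_top ENNReal.coe_ne_top hvG.1
        refine ⟨?_, toNNReal_le_of_le_coe (h.1 hv)⟩
        rw [← ENNReal.coe_le_coe, ENNReal.coe_toNNReal hfin, ENNReal.coe_inv hck]
        exact h.2 hv
      · simp only [hvG, if_false]
        exact ⟨inv_le_one_of_one_le₀ (hc1 k).le, (hc1 k).le⟩
    rw [tendsto_order]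
    constructor
    · intro a ha
      have hlim : Tendsto (fun k => (c k)⁻¹) atTop (𝓝 1) := by
        simpa using hclim.inv₀ one_ne_zero
      obtain ⟨k, hk⟩ := (hlim.eventually (lt_mem_nhds ha)).exists
      filter_upwards [Metric.ball_mem_nhds x (hρ k)] with v hv
      exact hk.trans_le (key k v hv).1
    · intro a ha
      obtain ⟨k, hk⟩ := (hclim.eventually (gt_mem_nhds ha)).exists
      filter_upwards [Metric.ball_mem_nhds x (hρ k)] with v hv
      exact (key k v hv).2.trans_lt hk
  · rw [hνf]
    refine withDensity_congr_ae ?_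
    filter_upwards [hGae] with v hv
    simp only [hv, if_true]
    exact (ENNReal.coe_toNNReal (ne_top_of_le_ne_top ENNReal.coe_ne_top hv.1)).symm

lemma euclideanHausdorffMeasure_image_le {X Y : Type*} [EMetricSpace X] [EMetricSpace Y]
    [MeasurableSpace X] [BorelSpace X] [MeasurableSpace Y] [BorelSpace Y] {L : ℝ≥0} {f : X → Y}
    {s : Set X} (h : LipschitzOnWith L f s) (d : ℕ) :
    μHE[d] (f '' s) ≤ (L : ℝ≥0∞) ^ d * μHE[d] s := by
  simp only [Measure.euclideanHausdorffMeasure_def, Measure.smul_apply]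
  have := h.hausdorffMeasure_image_le (d := d) (Nat.cast_nonneg d)
  rw [ENNReal.rpow_natCast] at this
  rw [mul_smul_comm]
  gcongr

/-- Let `H` be an injective parametrization which is almost isometric near `0`, with left inverse
`Q`. Then the Hausdorff measure on its image is given by a density that tends to `1` at `0`. -/
lemma exists_surface_density {V E : Type*} [NormedAddCommGroup V] [InnerProductSpace ℝ V]
    [FiniteDimensional ℝ V] [MeasurableSpace V] [BorelSpace V] [NormedAddCommGroup E]
    [MeasurableSpace E] [BorelSpace E] {d : ℕ} (hd : Module.finrank ℝ V = d)
    {H : V → E} {Q : E → V} (hH : Continuous H) (hQ : Continuous Q) (hQH : ∀ u, Q (H u) = u)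
    {K R : ℝ} (hR : 0 < R) (hK : 0 ≤ K) (hKR : K * R ≤ 1 / 2)
    (hlip : ∀ ρ < R, ∀ u ∈ Metric.closedBall 0 ρ, ∀ w ∈ Metric.closedBall 0 ρ,
      ‖H u - H w‖ ≤ (1 + K * ρ) * ‖u - w‖ ∧ (1 - K * ρ) * ‖u - w‖ ≤ ‖H u - H w‖) :
    MeasurableSet (H '' Metric.ball 0 R) ∧
    ∃ θ : V → ℝ≥0, Measurable θ ∧ (∀ v, θ v ≤ 2 ^ d) ∧ Tendsto θ (𝓝 0) (𝓝 1) ∧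
      (μHE[d] : Measure E).restrict (H '' Metric.ball 0 R)
        = (((volume : Measure V).restrict (Metric.ball 0 R)).withDensity (fun v => θ v)).map H := by
  set A := H '' Metric.ball 0 R with hA
  have hAm : MeasurableSet A := by
    -- The left inverse describes the image by an open and a closed condition, so it is Borel.
    have : A = Q ⁻¹' Metric.ball 0 R ∩ {y | H (Q y) = y} := by
      ext y
      constructor
      · rintro ⟨u, hu, rfl⟩
        simpa [hQH] using hu
      · rintro ⟨h1, h2⟩
        exact ⟨Q y, h1, h2⟩
    rw [this]
    exact (hQ.measurable Metric.isOpen_ball.measurableSet).inter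
      (isClosed_eq (hH.comp hQ) continuous_id).measurableSet
  refine ⟨hAm, ?_⟩
  have hvol : (volume : Measure V) = μHE[d] := by
    rw [← hd, InnerProductSpace.euclideanHausdorffMeasure_eq_volume]
  -- Surface measure is transported to the flat space by `Q`, where it can be compared with Lebesgue
  -- measure.
  set lam : Measure V := ((μHE[d] : Measure E).restrict A).map Q with hlam
  have hlamB : ∀ B, MeasurableSet B → lam B = μHE[d] (H '' (B ∩ Metric.ball 0 R)) := by
    intro B hB
    rw [hlam, Measure.map_apply hQ.measurable hB, Measure.restrict_apply (hQ.measurable hB)]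
    congr 1
    ext y
    constructor
    · rintro ⟨h1, u, hu, rfl⟩
      exact ⟨u, ⟨by simpa [hQH] using h1, hu⟩, rfl⟩
    · rintro ⟨u, ⟨h1, hu⟩, rfl⟩
      exact ⟨by simpa [hQH] using h1, u, hu, rfl⟩
  have hup : ∀ L : ℝ≥0, ∀ s, LipschitzOnWith L H s → ∀ B ⊆ s, MeasurableSet B →
      lam B ≤ (L : ℝ≥0∞) ^ d * volume B := by
    intro L s hL B hBs hB
    rw [hlamB B hB, hvol]
    refine (euclideanHausdorffMeasure_image_le (hL.mono (inter_subset_left.trans hBs)) d).trans ?_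
    gcongr
    exact inter_subset_left
  -- Crude bound: `1 + K R ≤ 3/2 ≤ 2`.
  have hlipR : LipschitzOnWith 2 H (Metric.ball 0 R) := by
    refine LipschitzOnWith.of_dist_le_mul fun u hu w hw => ?_
    have hu : ‖u‖ < R := by simpa using hu
    have hw : ‖w‖ < R := by simpa using hw
    have h1 := (hlip (max ‖u‖ ‖w‖) (max_lt hu hw) u (by simp) w (by simp)).1
    have h2 : K * max ‖u‖ ‖w‖ ≤ K * R := by gcongr; exact (max_lt hu hw).le
    rw [dist_eq_norm, dist_eq_norm]
    refine h1.trans ?_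
    push_cast
    gcongr
    linarith
  have hle : ∀ B, MeasurableSet B → lam B ≤ ((2 ^ d : ℝ≥0) : ℝ≥0∞) * volume B := by
    intro B hB
    have h1 : lam B = lam (B ∩ Metric.ball 0 R) := by
      rw [hlamB B hB, hlamB _ (hB.inter Metric.isOpen_ball.measurableSet), inter_assoc, inter_self]
    rw [h1]
    refine (hup 2 _ hlipR _ inter_subset_right (hB.inter Metric.isOpen_ball.measurableSet)).trans ?_
    push_cast
    gcongr
    exact inter_subset_left
  have hball : lam = lam.restrict (Metric.ball 0 R) := by
    ext B hB
    rw [Measure.restrict_apply hB, hlamB B hB,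
      hlamB _ (hB.inter Metric.isOpen_ball.measurableSet), inter_assoc, inter_self]
  have hfin : IsFiniteMeasure lam := by
    constructor
    rw [hball, Measure.restrict_apply_univ]
    refine (hle _ Metric.isOpen_ball.measurableSet).trans_lt ?_
    exact ENNReal.mul_lt_top ENNReal.coe_lt_top Metric.isBounded_ball.measure_lt_top
  have hloc : ∀ c : ℝ≥0, 1 < c → ∃ ρ > 0, ∀ B ⊆ Metric.ball (0 : V) ρ, MeasurableSet B →
      lam B ≤ c * volume B ∧ (c : ℝ≥0∞)⁻¹ * volume B ≤ lam B := by
    intro c hc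
    have hc' : (1 : ℝ) < c := hc
    have e1 : ∀ᶠ ρ in 𝓝[>] (0 : ℝ), (1 + K * ρ) ^ d < c := by
      have : ContinuousAt (fun ρ : ℝ => (1 + K * ρ) ^ d) 0 := by fun_prop
      exact nhdsWithin_le_nhds (this.tendsto.eventually (Iio_mem_nhds (by simpa using hc')))
    have e2 : ∀ᶠ ρ in 𝓝[>] (0 : ℝ), ((1 - K * ρ)⁻¹) ^ d < c := by
      have : ContinuousAt (fun ρ : ℝ => ((1 - K * ρ)⁻¹) ^ d) 0 :=
        ContinuousAt.pow (ContinuousAt.inv₀ (by fun_prop) (by simp)) d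
      exact nhdsWithin_le_nhds (this.tendsto.eventually (Iio_mem_nhds (by simpa using hc')))
    obtain ⟨ρ, h1, h2, hρ⟩ := (e1.and (e2.and (Ioo_mem_nhdsGT hR))).exists
    have hρ0 : 0 < ρ := hρ.1
    have hKρ : K * ρ ≤ K * R := by gcongr; exact hρ.2.le
    have hsub : Metric.ball (0 : V) ρ ⊆ Metric.ball 0 R := Metric.ball_subset_ball hρ.2.le
    refine ⟨ρ, hρ0, fun B hBs hB => ⟨?_, ?_⟩⟩
    · have hL : LipschitzOnWith (1 + K * ρ).toNNReal H (Metric.ball 0 ρ) := by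
        refine LipschitzOnWith.of_dist_le_mul fun u hu w hw => ?_
        rw [dist_eq_norm, dist_eq_norm, Real.coe_toNNReal _ (by positivity)]
        exact (hlip ρ hρ.2 u (Metric.ball_subset_closedBall hu) w
          (Metric.ball_subset_closedBall hw)).1
      refine (hup _ _ hL B hBs hB).trans ?_
      gcongr
      rw [← ENNReal.coe_pow, ENNReal.coe_le_coe, ← NNReal.coe_le_coe, NNReal.coe_pow,
        Real.coe_toNNReal _ (by positivity)]
      exact h1.le
    · have hpos : 0 < 1 - K * ρ := by linarith
      -- The lower bound on the surface measure is the Lipschitz estimate for the inverse map `Q`.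
      have hL : LipschitzOnWith (1 - K * ρ)⁻¹.toNNReal Q (H '' B) := by
        refine LipschitzOnWith.of_dist_le_mul ?_
        rintro _ ⟨u, hu, rfl⟩ _ ⟨w, hw, rfl⟩
        rw [dist_eq_norm, dist_eq_norm, Real.coe_toNNReal _ (by positivity), hQH, hQH,
          ← div_eq_inv_mul, le_div_iff₀ hpos, mul_comm]
        exact (hlip ρ hρ.2 u (Metric.ball_subset_closedBall (hBs hu)) w
          (Metric.ball_subset_closedBall (hBs hw))).2
      have h3 := euclideanHausdorffMeasure_image_le hL d
      have h4 : Q '' (H '' B) = B := by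
        rw [image_image]
        simp [hQH]
      rw [h4, ← hvol] at h3
      rw [ENNReal.inv_mul_le_iff (by simpa using (zero_lt_one.trans hc).ne') ENNReal.coe_ne_top,
        hlamB B hB, inter_eq_left.2 (hBs.trans hsub)]
      refine h3.trans ?_
      gcongr
      rw [← ENNReal.coe_pow, ENNReal.coe_le_coe, ← NNReal.coe_le_coe, NNReal.coe_pow,
        Real.coe_toNNReal _ (by positivity)]
      exact h2.le
  obtain ⟨θ, hθm, hθb, hθlim, hθ⟩ := exists_density_tendsto_one (one_le_pow₀ one_le_two) hle hloc
  refine ⟨θ, hθm, hθb, hθlim, ?_⟩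
  rw [← restrict_withDensity Metric.isOpen_ball.measurableSet, ← hθ, ← hball, hlam,
    Measure.map_map hH.measurable hQ.measurable]
  have : H ∘ Q =ᵐ[(μHE[d] : Measure E).restrict A] id := by
    filter_upwards [ae_restrict_mem hAm]
    rintro _ ⟨u, -, rfl⟩
    simp [hQH]
  rw [Measure.map_congr this, Measure.map_id]

end Density

/-! ### Graph functions, their zero sets and gradients. -/

section Graph

variable {n : ℕ}

lemma graphFun_add_smul {e : EuclideanSpace ℝ (Fin n)} (he : ‖e‖ = 1)
    (γ : EuclideanSpace ℝ (Fin n) → ℝ) (y : EuclideanSpace ℝ (Fin n)) (s : ℝ) :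
    graphFun e γ (y + s • e) = graphFun e γ y - s := by
  have h1 : inner ℝ e (y + s • e) = inner ℝ e y + s := by
    rw [inner_add_right, inner_smul_right, real_inner_self_eq_norm_sq, he]
    ring
  have h2 : y + s • e - (inner ℝ e y + s) • e = y - inner ℝ e y • e := by
    rw [add_smul]
    abel
  unfold graphFun
  rw [h1, h2]
  ring

lemma contDiff_graphFun {k : WithTop ℕ∞} (e : EuclideanSpace ℝ (Fin n))
    {γ : EuclideanSpace ℝ (Fin n) → ℝ} (hγ : ContDiff ℝ k γ) : ContDiff ℝ k (graphFun e γ) := by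
  have h1 : ContDiff ℝ k (fun y : EuclideanSpace ℝ (Fin n) => inner ℝ e y) :=
    contDiff_const.inner ℝ contDiff_id
  unfold graphFun
  fun_prop

/-- A zero of the graph function is a limit of points of `Ω`, since moving along `e` makes the
function negative; a point where it is positive has a neighbourhood missing `Ω`. -/
lemma IsC2GraphNear.mem_frontier_iff {Ω : Set (EuclideanSpace ℝ (Fin n))}
    {x e : EuclideanSpace ℝ (Fin n)} {r : ℝ} {γ : EuclideanSpace ℝ (Fin n) → ℝ}
    (h : IsC2GraphNear Ω x r e γ) (hΩ : IsOpen Ω) {y : EuclideanSpace ℝ (Fin n)}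
    (hy : y ∈ Metric.ball x r) : y ∈ frontier Ω ↔ graphFun e γ y = 0 := by
  have hc : Continuous (graphFun e γ) := (contDiff_graphFun e h.contDiff).continuous
  have hball : Metric.ball x r ∈ 𝓝 y := Metric.isOpen_ball.mem_nhds hy
  rw [hΩ.frontier_eq]
  constructor
  · rintro ⟨h1, h2⟩
    rw [h.mem_iff y hy, not_lt] at h2
    refine le_antisymm ?_ h2
    by_contra! h3
    obtain ⟨z, ⟨hz1, hz2⟩, hz3⟩ := mem_closure_iff_nhds.1 h1 _
      (inter_mem hball (hc.continuousAt.preimage_mem_nhds (Ioi_mem_nhds h3)))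
    have := (h.mem_iff z hz1).1 hz3
    have hz2 : 0 < graphFun e γ z := hz2
    linarith
  · intro h0
    refine ⟨?_, fun hmem => ?_⟩
    · have hline : Tendsto (fun s : ℝ => y + s • e) (𝓝[>] 0) (𝓝 y) := by
        have : Continuous (fun s : ℝ => y + s • e) := by fun_prop
        have h1 := this.tendsto 0
        simp only [zero_smul, add_zero] at h1
        exact h1.mono_left nhdsWithin_le_nhds
      refine mem_closure_of_tendsto hline ?_
      filter_upwards [hline hball, self_mem_nhdsWithin] with s hs1 hs2
      rw [h.mem_iff _ hs1, graphFun_add_smul h.norm_axis, h0]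
      have : 0 < s := hs2
      linarith
    · rw [h.mem_iff y hy, h0] at hmem
      exact lt_irrefl _ hmem

lemma fderiv_axis {E : Type*} [NormedAddCommGroup E] [NormedSpace ℝ E] {f : E → ℝ} {e x : E}
    {c : ℝ} (hf : DifferentiableAt ℝ f x) (hfe : ∀ y, ∀ s : ℝ, f (y + s • e) = f y + c * s) :
    fderiv ℝ f x e = c := by
  have h1 : HasDerivAt (fun s : ℝ => f (x + s • e)) (fderiv ℝ f x e) 0 := by
    have h2 : HasDerivAt (fun s : ℝ => x + s • e) e 0 := by
      simpa using ((hasDerivAt_id (0 : ℝ)).smul_const e).const_add x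
    have h3 : HasFDerivAt f (fderiv ℝ f x) (x + (0 : ℝ) • e) := by simpa using hf.hasFDerivAt
    exact h3.comp_hasDerivAt 0 h2
  have h4 : HasDerivAt (fun s : ℝ => f (x + s • e)) c 0 := by
    simp only [hfe]
    simpa using ((hasDerivAt_id (0 : ℝ)).const_mul c).const_add (f x)
  exact h1.unique h4

lemma inner_gradient_eq {E : Type*} [NormedAddCommGroup E] [InnerProductSpace ℝ E] [CompleteSpace E]
    (f : E → ℝ) (x v : E) : inner ℝ (gradient f x) v = fderiv ℝ f x v := by
  rw [gradient, InnerProductSpace.toDual_symm_apply]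

lemma eventually_neg_of_deriv_neg {E : Type*} [NormedAddCommGroup E] [NormedSpace ℝ E]
    {f : E → ℝ} {x v : E} (hf : DifferentiableAt ℝ f x) (hx : f x = 0) (hv : fderiv ℝ f x v < 0) :
    ∀ᶠ s in 𝓝[>] (0 : ℝ), f (x + s • v) < 0 := by
  have h2 : HasDerivAt (fun s : ℝ => x + s • v) v 0 := by
    simpa using ((hasDerivAt_id (0 : ℝ)).smul_const v).const_add x
  have h3 : HasFDerivAt f (fderiv ℝ f x) (x + (0 : ℝ) • v) := by simpa using hf.hasFDerivAt
  have h4 := h3.comp_hasDerivAt 0 h2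
  have h5 := h4.tendsto_slope_zero_right
  filter_upwards [h5.eventually (Iio_mem_nhds hv), self_mem_nhdsWithin] with s hs hs0
  have hs0 : 0 < s := hs0
  simp only [Function.comp, zero_add, zero_smul, add_zero, hx, sub_zero, smul_eq_mul] at hs
  by_contra! hcon
  have : 0 ≤ s⁻¹ * f (x + s • v) := by positivity
  exact absurd hs (not_lt.2 this)

/-- Two functions with the same negativity set near a common zero have positively parallel
gradients there. -/
lemma normalize_gradient_eq {E : Type*} [NormedAddCommGroup E] [InnerProductSpace ℝ E]
    [CompleteSpace E] {f g : E → ℝ} {x : E} (hf : DifferentiableAt ℝ f x)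
    (hg : DifferentiableAt ℝ g x) (hfx : f x = 0) (hgx : g x = 0) (hf0 : gradient f x ≠ 0)
    (hg0 : gradient g x ≠ 0) (h : ∀ᶠ y in 𝓝 x, f y < 0 ↔ g y < 0) :
    ‖gradient f x‖⁻¹ • gradient f x = ‖gradient g x‖⁻¹ • gradient g x := by
  set a := ‖gradient f x‖⁻¹ • gradient f x with ha
  set b := ‖gradient g x‖⁻¹ • gradient g x with hb
  have ha1 : ‖a‖ = 1 := norm_smul_inv_norm hf0
  have hb1 : ‖b‖ = 1 := norm_smul_inv_norm hg0
  -- Otherwise `f < 0 < g` at points `x + sv` with small `s > 0`.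
  have key : ∀ v, inner ℝ a v < 0 → inner ℝ b v ≤ 0 := by
    intro v hv
    rw [ha, real_inner_smul_left, inner_gradient_eq] at hv
    rw [hb, real_inner_smul_left, inner_gradient_eq]
    have hfv : fderiv ℝ f x v < 0 := by
      by_contra! hcon
      have : 0 ≤ ‖gradient f x‖⁻¹ * fderiv ℝ f x v := by positivity
      linarith
    suffices fderiv ℝ g x v ≤ 0 from mul_nonpos_of_nonneg_of_nonpos (by positivity) this
    by_contra! hgv
    have h1 := eventually_neg_of_deriv_neg hf hfx hfv
    have h2 := eventually_neg_of_deriv_neg (f := fun y => -g y) hg.neg (by simp [hgx])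
      (v := v) (by rw [fderiv_fun_neg]; simpa using hgv)
    have hline : Tendsto (fun s : ℝ => x + s • v) (𝓝[>] 0) (𝓝 x) := by
      have : Continuous (fun s : ℝ => x + s • v) := by fun_prop
      have h1 := this.tendsto 0
      simp only [zero_smul, add_zero] at h1
      exact h1.mono_left nhdsWithin_le_nhds
    obtain ⟨s, hs1, hs2, hs3⟩ := (h1.and (h2.and (hline.eventually h))).exists
    have := hs3.1 hs1
    linarith
  clear_value a b
  set q := inner ℝ a b with hq
  have hba : inner ℝ b a = q := real_inner_comm _ _
  have haa : inner ℝ a a = 1 := by rw [real_inner_self_eq_norm_sq, ha1]; norm_num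
  have hbb : inner ℝ b b = 1 := by rw [real_inner_self_eq_norm_sq, hb1]; norm_num
  have hq0 : 0 ≤ q := by
    have := key (-a) (by rw [inner_neg_right, haa]; norm_num)
    rw [inner_neg_right, hba] at this
    linarith
  have hq1 : q ≤ 1 := by
    have := real_inner_le_norm a b
    rw [ha1, hb1] at this
    linarith
  -- The test vector is the part of `b` orthogonal to `a`, tilted by `-εa` so that its product with
  -- `a` is `-ε < 0`. Letting `ε → 0` gives `q² ≥ 1`.
  have hε : ∀ ε > 0, 1 - q ^ 2 ≤ ε * q := by
    intro ε hε
    have := key (b - q • a - ε • a) (by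
      rw [inner_sub_right, inner_sub_right, inner_smul_right, inner_smul_right, haa, ← hq]
      linarith)
    rw [inner_sub_right, inner_sub_right, inner_smul_right, inner_smul_right, hbb, hba] at this
    linarith
  have hq2 : 1 - q ^ 2 ≤ 0 := by
    refine le_of_forall_pos_le_add fun ε hε' => ?_
    have := hε ε hε'
    nlinarith
  have hqe : q = 1 := by nlinarith
  exact (inner_eq_one_iff_of_norm_eq_one ha1 hb1).1 hqe

/-- A `C²` function is Lipschitz with small constant on small balls of a subspace on which its
derivative vanishes. -/
lemma exists_lipschitz_of_fderiv_eq_zero {E : Type*} [NormedAddCommGroup E] [NormedSpace ℝ E]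
    {f : E → ℝ} (hf : ContDiff ℝ 2 f) (x : E) (V : Submodule ℝ E)
    (hV : ∀ v ∈ V, fderiv ℝ f x v = 0) :
    ∃ K R : ℝ, 0 ≤ K ∧ 0 < R ∧ ∀ ρ < R, ∀ u ∈ Metric.closedBall (0 : V) ρ,
      ∀ w ∈ Metric.closedBall (0 : V) ρ, |f (x + u) - f (x + w)| ≤ K * ρ * ‖u - w‖ := by
  have h1 : ContDiff ℝ 1 (fderiv ℝ f) := hf.fderiv_right (by norm_num)
  obtain ⟨K, t, ht, hK⟩ := h1.contDiffAt (x := x) |>.exists_lipschitzOnWith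
  obtain ⟨R, hR, hball⟩ := Metric.mem_nhds_iff.1 ht
  refine ⟨K, R, K.2, hR, fun ρ hρ u hu w hw => ?_⟩
  have hder : ∀ v : V, HasFDerivAt (fun v : V => f (x + v))
      ((fderiv ℝ f (x + v)).comp V.subtypeL) v := by
    intro v
    have h2 : HasFDerivAt (fun v : V => x + (v : E)) V.subtypeL v :=
      V.subtypeL.hasFDerivAt.const_add x
    exact ((hf.differentiable (by norm_num)) (x + v)).hasFDerivAt.comp v h2
  have hbd : ∀ v ∈ Metric.closedBall (0 : V) ρ,
      ‖(fderiv ℝ f (x + v)).comp V.subtypeL‖ ≤ K * ρ := by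
    intro v hv
    have hv : ‖v‖ ≤ ρ := by simpa using hv
    have hρ0 : 0 ≤ ρ := (norm_nonneg _).trans hv
    refine ContinuousLinearMap.opNorm_le_bound _ (by positivity) fun z => ?_
    -- Subtracting the derivative at `x` is free on `V`, so the Lipschitz bound for the derivative
    -- yields the factor `ρ`.
    have h3 : ((fderiv ℝ f (x + v)).comp V.subtypeL) z
        = (fderiv ℝ f (x + v) - fderiv ℝ f x) z := by
      simp [hV z z.2]
    rw [h3]
    refine (ContinuousLinearMap.le_opNorm _ _).trans ?_
    have hxv : x + (v : E) ∈ t := hball (by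
      simpa [Metric.mem_ball, dist_eq_norm] using hv.trans_lt hρ)
    have h4 := hK.dist_le_mul _ hxv _ (hball (Metric.mem_ball_self hR))
    rw [dist_eq_norm, dist_eq_norm, add_sub_cancel_left] at h4
    have h5 : ‖(v : E)‖ ≤ ρ := hv
    have h6 : ‖(z : E)‖ = ‖z‖ := rfl
    rw [h6]
    gcongr
    exact h4.trans (by gcongr)
  have := (convex_closedBall (0 : V) ρ).norm_image_sub_le_of_norm_hasFDerivWithin_le
    (fun v _ => (hder v).hasFDerivWithinAt) hbd hw hu
  simpa [Real.norm_eq_abs] using this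

end Graph

/-! ### Charts over the tangent plane. -/

section Chart

variable {n : ℕ}

/-- The parametrization of the zero set of `f` near `x` over its tangent space `ν^⟂`, along the
axis `e`. -/
noncomputable def graphParam (x ν e : EuclideanSpace ℝ (Fin n)) (f : EuclideanSpace ℝ (Fin n) → ℝ)
    (u : (ℝ ∙ ν)ᗮ) : EuclideanSpace ℝ (Fin n) :=
  x + u + f (x + u) • e

/-- Near `x`, the set `F` is parametrized by `graphParam x ν e f` over the ball of radius `R` in its
tangent space, and its surface measure has the density `θ` in this parametrization. -/
structure IsSurfaceChart (F : Set (EuclideanSpace ℝ (Fin n))) (x ν e : EuclideanSpace ℝ (Fin n))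
    (f : EuclideanSpace ℝ (Fin n) → ℝ) (K R : ℝ) (θ : (ℝ ∙ ν)ᗮ → NNReal) : Prop where
  K_nonneg : 0 ≤ K
  R_pos : 0 < R
  K_mul_R : K * R ≤ 1 / 2
  norm_axis : ‖e‖ = 1
  norm_normal : ‖ν‖ = 1
  inner_ne_zero : inner ℝ ν e ≠ 0
  continuous : Continuous f
  apply_zero : f x = 0
  mapsTo : ∀ u ∈ Metric.ball 0 R, graphParam x ν e f u ∈ F
  cover : ∃ δ > 0, F ∩ Metric.ball x δ ⊆ graphParam x ν e f '' Metric.ball 0 R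
  abs_le : ∀ u ∈ Metric.ball (0 : (ℝ ∙ ν)ᗮ) R, |f (x + u)| ≤ K * ‖u‖ ^ 2
  measurableSet_image : MeasurableSet (graphParam x ν e f '' Metric.ball 0 R)
  measurable_density : Measurable θ
  density_le : ∀ u, θ u ≤ 2 ^ (n - 1)
  tendsto_density : Tendsto θ (𝓝 0) (𝓝 1)
  measure_eq : (μHE[n - 1] : Measure (EuclideanSpace ℝ (Fin n))).restrict
      (graphParam x ν e f '' Metric.ball 0 R)
        = (((volume : Measure (ℝ ∙ ν)ᗮ).restrict (Metric.ball 0 R)).withDensity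
          (fun u => θ u)).map (graphParam x ν e f)

/-- Since `f` has slope `-1` along `e`, adding `f(x+u) e` to `x+u` lands on the zero set. The
derivative at `x` vanishes on `ν^⟂`, so this correction is quadratically small and the
parametrization is almost isometric near `0`. The axis `e` need not be normal; it is only transverse
to `ν^⟂`. -/
lemma exists_isSurfaceChart (hn : 1 ≤ n) {f : EuclideanSpace ℝ (Fin n) → ℝ} (hf : ContDiff ℝ 2 f)
    {e : EuclideanSpace ℝ (Fin n)} (he : ‖e‖ = 1) (hfe : ∀ y, ∀ s : ℝ, f (y + s • e) = f y - s)
    {x ν : EuclideanSpace ℝ (Fin n)} (hfx : f x = 0)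
    (hν : ν = ‖gradient f x‖⁻¹ • gradient f x) {F : Set (EuclideanSpace ℝ (Fin n))} {r : ℝ}
    (hr : 0 < r) (hF : ∀ y ∈ Metric.ball x r, y ∈ F ↔ f y = 0) :
    ∃ K R θ, IsSurfaceChart F x ν e f K R θ := by
  have hdiff : DifferentiableAt ℝ f x := (hf.differentiable (by norm_num)) x
  have hDe : fderiv ℝ f x e = -1 := fderiv_axis hdiff (by intro y s; rw [hfe]; ring)
  have hN : gradient f x ≠ 0 := by
    intro h0
    have := inner_gradient_eq f x e
    rw [h0, inner_zero_left, hDe] at this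
    norm_num at this
  have hNpos : 0 < ‖gradient f x‖ := norm_pos_iff.2 hN
  have hν1 : ‖ν‖ = 1 := by rw [hν]; exact norm_smul_inv_norm hN
  have hνe : inner ℝ ν e ≠ 0 := by
    rw [hν, real_inner_smul_left, inner_gradient_eq, hDe]
    simp [hN]
  have hνu : ∀ u ∈ (ℝ ∙ ν)ᗮ, inner ℝ ν u = 0 := fun u hu =>
    Submodule.mem_orthogonal_singleton_iff_inner_right.1 hu
  have hker : ∀ v ∈ (ℝ ∙ ν)ᗮ, fderiv ℝ f x v = 0 := by
    intro v hv
    have h1 := hνu v hv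
    rw [hν, real_inner_smul_left, inner_gradient_eq] at h1
    rcases mul_eq_zero.1 h1 with h2 | h2
    · exact absurd h2 (by positivity)
    · exact h2
  obtain ⟨K, R₀, hK, hR₀, hlip⟩ := exists_lipschitz_of_fderiv_eq_zero hf x _ hker
  -- `K R ≤ 1/2` keeps the parametrization bi-Lipschitz, and `2R ≤ r` keeps its image in the ball
  -- where `hF` applies.
  obtain ⟨R, hR, hRR₀, hKR, hRr⟩ : ∃ R : ℝ, 0 < R ∧ R ≤ R₀ ∧ K * R ≤ 1 / 2 ∧ 2 * R ≤ r := by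
    refine ⟨min R₀ (min (1 / (2 * (K + 1))) (r / 2)), by positivity, min_le_left _ _, ?_, ?_⟩
    · have h1 : min R₀ (min (1 / (2 * (K + 1))) (r / 2)) ≤ 1 / (2 * (K + 1)) :=
        (min_le_right _ _).trans (min_le_left _ _)
      calc K * min R₀ (min (1 / (2 * (K + 1))) (r / 2)) ≤ (K + 1) * (1 / (2 * (K + 1))) := by
            gcongr
            linarith
        _ = 1 / 2 := by field_simp
    · have h1 : min R₀ (min (1 / (2 * (K + 1))) (r / 2)) ≤ r / 2 :=
        (min_le_right _ _).trans (min_le_right _ _)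
      linarith
  have hlip' : ∀ ρ < R, ∀ u ∈ Metric.closedBall (0 : (ℝ ∙ ν)ᗮ) ρ,
      ∀ w ∈ Metric.closedBall (0 : (ℝ ∙ ν)ᗮ) ρ, |f (x + u) - f (x + w)| ≤ K * ρ * ‖u - w‖ :=
    fun ρ hρ => hlip ρ (hρ.trans_le hRR₀)
  have habs : ∀ u ∈ Metric.ball (0 : (ℝ ∙ ν)ᗮ) R, |f (x + u)| ≤ K * ‖u‖ ^ 2 := by
    intro u hu
    have := hlip' ‖u‖ (by simpa using hu) u (by simp) 0 (by simp)
    simp only [ZeroMemClass.coe_zero, add_zero, hfx, sub_zero] at this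
    linarith
  have hf0 : ∀ u, f (graphParam x ν e f u) = 0 := by
    intro u
    rw [graphParam, hfe, sub_self]
  have hball : ∀ u ∈ Metric.ball (0 : (ℝ ∙ ν)ᗮ) R, graphParam x ν e f u ∈ Metric.ball x r := by
    intro u hu
    have h1 := habs u hu
    have h2 : ‖u‖ < R := by simpa using hu
    have h3 : graphParam x ν e f u - x = u + f (x + u) • e := by
      unfold graphParam
      abel
    rw [Metric.mem_ball, dist_eq_norm, h3]
    have h4 : ‖(u : EuclideanSpace ℝ (Fin n)) + f (x + u) • e‖ ≤ ‖u‖ + |f (x + u)| := by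
      refine (norm_add_le _ _).trans ?_
      rw [norm_smul, he, mul_one]
      rfl
    have h5 : K * ‖u‖ ^ 2 ≤ (K * R) * ‖u‖ := by
      have : ‖u‖ ^ 2 ≤ R * ‖u‖ := by rw [sq]; gcongr
      calc K * ‖u‖ ^ 2 ≤ K * (R * ‖u‖) := by gcongr
        _ = _ := by ring
    have h6 : (K * R) * ‖u‖ ≤ 1 / 2 * ‖u‖ := by gcongr
    linarith [norm_nonneg u]
  -- The oblique projection onto `ν^⟂` along `e`; it forgets the correction term and so inverts the
  -- parametrization.
  let Q₀ : EuclideanSpace ℝ (Fin n) →L[ℝ] EuclideanSpace ℝ (Fin n) :=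
    ContinuousLinearMap.id ℝ _ - (((inner ℝ ν e)⁻¹ • innerSL ℝ ν).smulRight e)
  have hQ₀ : ∀ z, Q₀ z = z - ((inner ℝ ν e)⁻¹ * inner ℝ ν z) • e := fun z => by simp [Q₀]
  let Q : EuclideanSpace ℝ (Fin n) → (ℝ ∙ ν)ᗮ := fun y => ⟨Q₀ (y - x), by
    rw [Submodule.mem_orthogonal_singleton_iff_inner_right, hQ₀, inner_sub_right, inner_smul_right]
    field_simp
    ring⟩
  have hQcoe : ∀ y, (Q y : EuclideanSpace ℝ (Fin n)) = Q₀ (y - x) := fun y => rfl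
  have hQc : Continuous Q := Continuous.subtype_mk (by fun_prop) _
  have hHc : Continuous (graphParam x ν e f) := by
    have := hf.continuous
    unfold graphParam
    fun_prop
  have hQH : ∀ u, Q (graphParam x ν e f u) = u := by
    intro u
    ext1
    have h3 : graphParam x ν e f u - x = u + f (x + u) • e := by
      unfold graphParam
      abel
    rw [hQcoe, h3, hQ₀, inner_add_right, inner_smul_right, hνu u u.2, zero_add, mul_comm,
      mul_assoc, mul_inv_cancel₀ hνe, mul_one, add_sub_cancel_right]
  have hHdiff : ∀ u w : (ℝ ∙ ν)ᗮ, graphParam x ν e f u - graphParam x ν e f w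
      = ((u - w : (ℝ ∙ ν)ᗮ) : EuclideanSpace ℝ (Fin n)) + (f (x + u) - f (x + w)) • e := by
    intro u w
    unfold graphParam
    rw [sub_smul, Submodule.coe_sub]
    abel
  have hfr : Fact (Module.finrank ℝ (EuclideanSpace ℝ (Fin n)) = (n - 1) + 1) := ⟨by
    rw [finrank_euclideanSpace_fin]; omega⟩
  have hν0 : ν ≠ 0 := by
    rintro rfl
    simp at hν1
  obtain ⟨hAm, θ, hθ1, hθ2, hθ3, hθ4⟩ := exists_surface_density
    (Submodule.finrank_orthogonal_span_singleton (𝕜 := ℝ) (n := n - 1) hν0) hHc hQc hQH hR hK hKR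
    (by
      intro ρ hρ u hu w hw
      have h1 := hlip' ρ hρ u hu w hw
      have h2 : ‖(f (x + u) - f (x + w)) • e‖ = |f (x + u) - f (x + w)| := by
        rw [norm_smul, he, mul_one, Real.norm_eq_abs]
      have h3 : ‖((u - w : (ℝ ∙ ν)ᗮ) : EuclideanSpace ℝ (Fin n))‖ = ‖u - w‖ := rfl
      rw [hHdiff]
      constructor
      · refine (norm_add_le _ _).trans ?_
        rw [h2, h3]
        linarith
      · have := norm_sub_le_norm_add ((u - w : (ℝ ∙ ν)ᗮ) : EuclideanSpace ℝ (Fin n))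
          ((f (x + u) - f (x + w)) • e)
        rw [h2, h3] at this
        linarith)
  refine ⟨K, R, θ, hK, hR, hKR, he, hν1, hνe, hf.continuous, hfx, ?_, ?_, habs, hAm, hθ1, hθ2, hθ3,
    hθ4⟩
  · intro u hu
    exact (hF _ (hball u hu)).2 (hf0 u)
  · have hQx : Q x = 0 := by
      ext1
      rw [hQcoe, sub_self, map_zero]
      rfl
    have h1 : ∀ᶠ y in 𝓝 x, Q y ∈ Metric.ball 0 R :=
      hQc.continuousAt.eventually (by rw [hQx]; exact Metric.ball_mem_nhds _ hR)
    obtain ⟨δ, hδ, hsub⟩ := Metric.mem_nhds_iff.1 (h1.and (Metric.ball_mem_nhds x hr))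
    refine ⟨δ, hδ, ?_⟩
    rintro y ⟨hyF, hyδ⟩
    obtain ⟨h2, h3⟩ := hsub hyδ
    refine ⟨Q y, h2, ?_⟩
    have h4 : f y = 0 := (hF y h3).1 hyF
    have h5 : x + (Q y : EuclideanSpace ℝ (Fin n))
        = y + (-((inner ℝ ν e)⁻¹ * inner ℝ ν (y - x))) • e := by
      rw [hQcoe, hQ₀, neg_smul]
      abel
    unfold graphParam
    rw [h5, hfe, h4, zero_sub, neg_neg, add_assoc, ← add_smul, neg_add_cancel, zero_smul, add_zero]

end Chart

/-! ### Estimates on the surface read off from a chart. -/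

section ChartConsequences

variable {n : ℕ} {F : Set (EuclideanSpace ℝ (Fin n))} {x ν e : EuclideanSpace ℝ (Fin n)}
  {f : EuclideanSpace ℝ (Fin n) → ℝ} {K R : ℝ} {θ : (ℝ ∙ ν)ᗮ → NNReal}

lemma graphParam_sub (x ν e : EuclideanSpace ℝ (Fin n)) (f : EuclideanSpace ℝ (Fin n) → ℝ)
    (u : (ℝ ∙ ν)ᗮ) : graphParam x ν e f u - x = u + f (x + u) • e := by
  unfold graphParam
  abel

namespace IsSurfaceChart

lemma continuous_graphParam (c : IsSurfaceChart F x ν e f K R θ) :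
    Continuous (graphParam x ν e f) := by
  have := c.continuous
  unfold graphParam
  fun_prop

lemma graphParam_zero (c : IsSurfaceChart F x ν e f K R θ) : graphParam x ν e f 0 = x := by
  simp [graphParam, c.apply_zero]

lemma abs_le_half (c : IsSurfaceChart F x ν e f K R θ) {u : (ℝ ∙ ν)ᗮ}
    (hu : u ∈ Metric.ball 0 R) : |f (x + u)| ≤ ‖u‖ / 2 := by
  have h2 : ‖u‖ < R := by simpa using hu
  have hK := c.K_nonneg
  have hKR := c.K_mul_R
  calc |f (x + u)| ≤ K * ‖u‖ ^ 2 := c.abs_le u hu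
    _ = (K * ‖u‖) * ‖u‖ := by ring
    _ ≤ (K * R) * ‖u‖ := by gcongr
    _ ≤ (1 / 2) * ‖u‖ := by gcongr
    _ = ‖u‖ / 2 := by ring

lemma half_norm_le (c : IsSurfaceChart F x ν e f K R θ) {u : (ℝ ∙ ν)ᗮ}
    (hu : u ∈ Metric.ball 0 R) : ‖u‖ / 2 ≤ ‖graphParam x ν e f u - x‖ := by
  have h1 := c.abs_le_half hu
  have h2 := norm_sub_le_norm_add (u : EuclideanSpace ℝ (Fin n)) (f (x + u) • e)
  rw [norm_smul, c.norm_axis, mul_one, Real.norm_eq_abs] at h2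
  rw [graphParam_sub]
  have h3 : ‖(u : EuclideanSpace ℝ (Fin n))‖ = ‖u‖ := rfl
  linarith

/-- A `C²` hypersurface deviates quadratically from its tangent plane. -/
lemma exists_abs_inner_le (c : IsSurfaceChart F x ν e f K R θ) :
    ∃ C > 0, ∀ y ∈ F, |inner ℝ (y - x) ν| ≤ C * ‖y - x‖ ^ 2 := by
  obtain ⟨δ, hδ, hcov⟩ := c.cover
  have hK := c.K_nonneg
  -- Inside the chart `|u| ≤ 2|y - x|` gives `4K`; outside, `|y - x| ≥ δ` makes the linear bound
  -- quadratic with constant `1/δ`.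
  refine ⟨4 * K + 1 / δ, by positivity, fun y hy => ?_⟩
  by_cases hyδ : ‖y - x‖ < δ
  · obtain ⟨u, hu, rfl⟩ := hcov ⟨hy, by rwa [Metric.mem_ball, dist_eq_norm]⟩
    have h1 := c.half_norm_le hu
    have h2 : inner ℝ (u : EuclideanSpace ℝ (Fin n)) ν = 0 :=
      Submodule.mem_orthogonal_singleton_iff_inner_left.1 u.2
    have h3 : |inner ℝ (graphParam x ν e f u - x) ν| ≤ K * ‖u‖ ^ 2 := by
      rw [graphParam_sub, inner_add_left, h2, zero_add, real_inner_smul_left, abs_mul]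
      have h4 := abs_real_inner_le_norm e ν
      rw [c.norm_axis, c.norm_normal, mul_one] at h4
      calc |f (x + u)| * |inner ℝ e ν| ≤ |f (x + u)| * 1 := by gcongr
        _ = |f (x + u)| := mul_one _
        _ ≤ _ := c.abs_le u hu
    have h5 : ‖u‖ ^ 2 ≤ 4 * ‖graphParam x ν e f u - x‖ ^ 2 := by nlinarith [norm_nonneg u]
    calc _ ≤ K * ‖u‖ ^ 2 := h3
      _ ≤ K * (4 * ‖graphParam x ν e f u - x‖ ^ 2) := by gcongr
      _ = 4 * K * ‖graphParam x ν e f u - x‖ ^ 2 := by ring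
      _ ≤ _ := by
        gcongr
        have : 0 < 1 / δ := by positivity
        linarith
  · rw [not_lt] at hyδ
    have h4 := abs_real_inner_le_norm (y - x) ν
    rw [c.norm_normal, mul_one] at h4
    calc _ ≤ ‖y - x‖ := h4
      _ = 1 / δ * (δ * ‖y - x‖) := by field_simp
      _ ≤ 1 / δ * (‖y - x‖ * ‖y - x‖) := by gcongr
      _ = 1 / δ * ‖y - x‖ ^ 2 := by ring
      _ ≤ _ := by
        gcongr
        linarith

lemma measure_image_lt_top (c : IsSurfaceChart F x ν e f K R θ) :
    μHE[n - 1] (graphParam x ν e f '' Metric.ball 0 R) < ⊤ := by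
  rw [← Measure.restrict_apply_univ, c.measure_eq,
    Measure.map_apply c.continuous_graphParam.measurable MeasurableSet.univ, preimage_univ,
    withDensity_apply _ MeasurableSet.univ]
  calc ∫⁻ u in univ, θ u ∂((volume : Measure (ℝ ∙ ν)ᗮ).restrict (Metric.ball 0 R))
      ≤ ∫⁻ u in univ, ((2 ^ (n - 1) : NNReal) : ENNReal)
        ∂((volume : Measure (ℝ ∙ ν)ᗮ).restrict (Metric.ball 0 R)) := by
        gcongr with u
        exact c.density_le u
    _ < ⊤ := by
        rw [setLIntegral_const, Measure.restrict_apply_univ]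
        exact ENNReal.mul_lt_top ENNReal.coe_lt_top Metric.isBounded_ball.measure_lt_top

lemma image_subset (c : IsSurfaceChart F x ν e f K R θ) :
    graphParam x ν e f '' Metric.ball 0 R ⊆ F := by
  rintro _ ⟨u, hu, rfl⟩
  exact c.mapsTo u hu

lemma finiteAtFilter (c : IsSurfaceChart F x ν e f K R θ) :
    (μHE[n - 1] : Measure (EuclideanSpace ℝ (Fin n))).FiniteAtFilter (𝓝[F] x) := by
  obtain ⟨δ, hδ, hcov⟩ := c.cover
  refine ⟨F ∩ Metric.ball x δ, ?_, (measure_mono hcov).trans_lt c.measure_image_lt_top⟩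
  exact inter_mem self_mem_nhdsWithin (mem_nhdsWithin_of_mem_nhds (Metric.ball_mem_nhds x hδ))

lemma setIntegral_image (c : IsSurfaceChart F x ν e f K R θ) {g : EuclideanSpace ℝ (Fin n) → ℝ}
    (hg : Measurable g) :
    ∫ y in graphParam x ν e f '' Metric.ball 0 R, g y ∂μHE[n - 1]
      = ∫ u in Metric.ball 0 R, θ u * g (graphParam x ν e f u) := by
  rw [c.measure_eq, integral_map c.continuous_graphParam.measurable.aemeasurable
    hg.aestronglyMeasurable, integral_withDensity_eq_integral_smul c.measurable_density]
  rfl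

lemma exists_far (c : IsSurfaceChart F x ν e f K R θ) :
    ∃ δ > 0, ∀ y ∈ F \ graphParam x ν e f '' Metric.ball 0 R, δ ≤ ‖y - x‖ := by
  obtain ⟨δ, hδ, hcov⟩ := c.cover
  refine ⟨δ, hδ, fun y hy => ?_⟩
  by_contra! h
  exact hy.2 (hcov ⟨hy.1, by rwa [Metric.mem_ball, dist_eq_norm]⟩)

end IsSurfaceChart

/-- The inequality `a ≤ exp a` at `a = δ/(ms)`, raised to the power `m`. -/
lemma rpow_mul_exp_neg_div_le {m δ : ℝ} (hm : 0 < m) (hδ : 0 < δ) {s : ℝ} (hs : 0 < s) :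
    (1 / s ^ m) * Real.exp (-δ / s) ≤ (m / δ) ^ m := by
  have h1 : δ / (m * s) ≤ Real.exp (δ / (m * s)) := by
    linarith [Real.add_one_le_exp (δ / (m * s))]
  have h2 : (δ / (m * s)) ^ m ≤ Real.exp (δ / s) := by
    calc (δ / (m * s)) ^ m ≤ (Real.exp (δ / (m * s))) ^ m :=
          Real.rpow_le_rpow (by positivity) h1 hm.le
      _ = Real.exp (δ / s) := by
          rw [← Real.exp_mul]
          congr 1
          field_simp
  have h4 : 0 < (m / δ) ^ m := by positivity
  have h5 : 0 < s ^ m := by positivity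
  have h3 : (δ / (m * s)) ^ m * ((m / δ) ^ m * s ^ m) = 1 := by
    rw [← Real.mul_rpow (by positivity) (by positivity),
      ← Real.mul_rpow (by positivity) (by positivity),
      show δ / (m * s) * (m / δ * s) = 1 by field_simp, Real.one_rpow]
  rw [neg_div, Real.exp_neg, ← div_eq_mul_inv, div_le_iff₀ (Real.exp_pos _)]
  calc 1 / s ^ m = (m / δ) ^ m * (δ / (m * s)) ^ m := by
        rw [div_eq_iff h5.ne', ← h3]
        ring
    _ ≤ _ := by gcongr

/-- Within the chart this is a flat Gaussian integral in dimension `n-1`, up to constants; away from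
`x` the exponential is smaller than any power of `s`. -/
lemma IsSurfaceChart.exists_integral_exp_le (hn : 2 ≤ n) (c : IsSurfaceChart F x ν e f K R θ)
    (hF : MeasurableSet F) (hfin : μHE[n - 1] F < ⊤) :
    ∃ C, 0 ≤ C ∧ ∀ s, 0 < s → ∫ y in F, Real.exp (-‖y - x‖ ^ 2 / (16 * s)) ∂μHE[n - 1]
      ≤ C * s ^ (((n - 1 : ℕ) : ℝ) / 2) := by
  obtain ⟨δ, hδ, hfar⟩ := c.exists_far
  set d := n - 1 with hd
  have hd0 : 0 < (d : ℝ) / 2 := by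
    have : 0 < d := by omega
    positivity
  set A := graphParam x ν e f '' Metric.ball 0 R with hA
  set μ : Measure (EuclideanSpace ℝ (Fin n)) := μHE[d] with hμ
  have hfr : Fact (Module.finrank ℝ (EuclideanSpace ℝ (Fin n)) = d + 1) := ⟨by
    rw [finrank_euclideanSpace_fin]; omega⟩
  have hν0 : ν ≠ 0 := by
    intro h
    have := c.norm_normal
    simp [h] at this
  have hrank : Module.finrank ℝ (ℝ ∙ ν)ᗮ = d :=
    Submodule.finrank_orthogonal_span_singleton (𝕜 := ℝ) (n := d) hν0
  refine ⟨2 ^ d * (64 * Real.pi) ^ ((d : ℝ) / 2)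
    + ((d : ℝ) / 2 / (δ ^ 2 / 16)) ^ ((d : ℝ) / 2) * μ.real F, by positivity, fun s hs => ?_⟩
  have hgm : Measurable (fun y => Real.exp (-‖y - x‖ ^ 2 / (16 * s))) := by fun_prop
  have hg1 : ∀ y, ‖Real.exp (-‖y - x‖ ^ 2 / (16 * s))‖ ≤ 1 := by
    intro y
    rw [Real.norm_of_nonneg (Real.exp_pos _).le, Real.exp_le_one_iff]
    have : 0 ≤ ‖y - x‖ ^ 2 / (16 * s) := by positivity
    rw [neg_div]
    linarith
  have hint : IntegrableOn (fun y => Real.exp (-‖y - x‖ ^ 2 / (16 * s))) F μ :=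
    Measure.integrableOn_of_bounded hfin.ne hgm.aestronglyMeasurable
      (Eventually.of_forall hg1)
  have hnear : ∫ y in A, Real.exp (-‖y - x‖ ^ 2 / (16 * s)) ∂μ
      ≤ 2 ^ d * (64 * Real.pi) ^ ((d : ℝ) / 2) * s ^ ((d : ℝ) / 2) := by
    have h64 : ∀ u : (ℝ ∙ ν)ᗮ, Real.exp (-(1 / 16 * ‖u‖ ^ 2) / (4 * s))
        = Real.exp (-(‖u‖ / 2) ^ 2 / (16 * s)) := by
      intro u
      congr 1
      field_simp
      ring
    have hI : Integrable (fun u : (ℝ ∙ ν)ᗮ => 2 ^ d * Real.exp (-(1 / 16 * ‖u‖ ^ 2) / (4 * s))) :=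
      (integrable_exp_neg_sq_div hs (by norm_num)).const_mul _
    rw [hA, hμ, hd, c.setIntegral_image hgm, ← hd]
    calc ∫ u in Metric.ball 0 R, θ u * Real.exp (-‖graphParam x ν e f u - x‖ ^ 2 / (16 * s))
        ≤ ∫ u in Metric.ball 0 R, 2 ^ d * Real.exp (-(1 / 16 * ‖u‖ ^ 2) / (4 * s)) := by
          refine integral_mono_of_nonneg (Eventually.of_forall fun u => by positivity)
            hI.integrableOn ?_
          filter_upwards [ae_restrict_mem Metric.isOpen_ball.measurableSet] with u hu
          have h1 := c.half_norm_le hu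
          have h2 : (θ u : ℝ) ≤ 2 ^ d := by exact_mod_cast c.density_le u
          simp only [h64]
          gcongr
      _ ≤ ∫ u : (ℝ ∙ ν)ᗮ, 2 ^ d * Real.exp (-(1 / 16 * ‖u‖ ^ 2) / (4 * s)) :=
          setIntegral_le_integral hI (Eventually.of_forall fun u => by positivity)
      _ = _ := by
          rw [integral_const_mul, integral_exp_neg_sq_div hs (by norm_num), hrank,
            mul_assoc ((2 : ℝ) ^ d), ← Real.mul_rpow (by positivity) hs.le]
          congr 2
          ring
  have hfarI : ∫ y in F \ A, Real.exp (-‖y - x‖ ^ 2 / (16 * s)) ∂μ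
      ≤ ((d : ℝ) / 2 / (δ ^ 2 / 16)) ^ ((d : ℝ) / 2) * μ.real F * s ^ ((d : ℝ) / 2) := by
    have hb : ∀ y ∈ F \ A, Real.exp (-‖y - x‖ ^ 2 / (16 * s))
        ≤ ((d : ℝ) / 2 / (δ ^ 2 / 16)) ^ ((d : ℝ) / 2) * s ^ ((d : ℝ) / 2) := by
      intro y hy
      have h1 := rpow_mul_exp_neg_div_le hd0 (by positivity : 0 < δ ^ 2 / 16) hs
      have h2 : 0 < s ^ ((d : ℝ) / 2) := by positivity
      rw [one_div, ← div_eq_inv_mul, div_le_iff₀ h2] at h1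
      refine le_trans ?_ h1
      rw [show -(δ ^ 2 / 16) / s = -δ ^ 2 / (16 * s) by field_simp]
      have := hfar y hy
      gcongr
    calc ∫ y in F \ A, Real.exp (-‖y - x‖ ^ 2 / (16 * s)) ∂μ
        ≤ ∫ y in F \ A, ((d : ℝ) / 2 / (δ ^ 2 / 16)) ^ ((d : ℝ) / 2) * s ^ ((d : ℝ) / 2) ∂μ := by
          refine setIntegral_mono_on (hint.mono_set sdiff_subset) ?_
            (hF.diff c.measurableSet_image) hb
          exact integrableOn_const ((measure_mono sdiff_subset).trans_lt hfin).ne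
      _ = ((d : ℝ) / 2 / (δ ^ 2 / 16)) ^ ((d : ℝ) / 2) * s ^ ((d : ℝ) / 2) * μ.real (F \ A) := by
          rw [setIntegral_const, smul_eq_mul]
          ring
      _ ≤ ((d : ℝ) / 2 / (δ ^ 2 / 16)) ^ ((d : ℝ) / 2) * s ^ ((d : ℝ) / 2) * μ.real F := by
          gcongr
          · exact hfin.ne
          · exact sdiff_subset
      _ = _ := by ring
  have hsplit := setIntegral_union (μ := μ) (disjoint_sdiff_left : Disjoint (F \ A) A)
    c.measurableSet_image (hint.mono_set sdiff_subset) (hint.mono_set c.image_subset)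
  rw [sdiff_union_of_subset c.image_subset] at hsplit
  rw [hsplit]
  linarith

/-- Near a point of its relative boundary, a region with `C¹` relative boundary looks like a half
hyperplane. -/
lemma IsSurfaceChart.exists_halfSpace (c : IsSurfaceChart F x ν e f K R θ)
    {S : Set (EuclideanSpace ℝ (Fin n))} {p : EuclideanSpace ℝ (Fin n) → ℝ} {r : ℝ} (hr : 0 < r)
    (hp : DifferentiableAt ℝ p x) (hpx : p x = 0) (hpe : ∀ y, ∀ s : ℝ, p (y + s • e) = p y)
    (hp0 : fderiv ℝ p x ≠ 0) (hS : ∀ y ∈ F ∩ Metric.ball x r, y ∈ S ↔ 0 < p y) :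
    ∃ ℓ : (ℝ ∙ ν)ᗮ →L[ℝ] ℝ, ℓ ≠ 0 ∧ ∀ w, ℓ w ≠ 0 →
      ∀ᶠ h in 𝓝[>] (0 : ℝ), (graphParam x ν e f (h • w) ∈ S ↔ 0 < ℓ w) := by
  refine ⟨(fderiv ℝ p x).comp (ℝ ∙ ν)ᗮ.subtypeL, ?_, ?_⟩
  · intro h0
    apply hp0
    -- The derivative of `p` kills `e`, and `e` together with `ν^⟂` spans the space; so it cannot
    -- also vanish on `ν^⟂`.
    have hDe : fderiv ℝ p x e = 0 := fderiv_axis hp (by simpa using hpe)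
    ext z
    set s := inner ℝ ν z / inner ℝ ν e with hs
    have hz : z - s • e ∈ (ℝ ∙ ν)ᗮ := by
      rw [Submodule.mem_orthogonal_singleton_iff_inner_right, inner_sub_right, inner_smul_right, hs,
        div_mul_cancel₀ _ c.inner_ne_zero, sub_self]
    have h1 : fderiv ℝ p x (z - s • e) = 0 := by
      simpa using congrArg (fun L => L ⟨z - s • e, hz⟩) h0
    rw [map_sub, map_smul, hDe, smul_zero, sub_zero] at h1
    simpa using h1
  · intro w hw
    have hline : Tendsto (fun h : ℝ => h • w) (𝓝[>] 0) (𝓝 0) := by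
      have : Continuous (fun h : ℝ => h • w) := by fun_prop
      have h1 := this.tendsto 0
      rw [zero_smul] at h1
      exact h1.mono_left nhdsWithin_le_nhds
    have hball : ∀ᶠ h in 𝓝[>] (0 : ℝ), graphParam x ν e f (h • w) ∈ F ∩ Metric.ball x r := by
      have h2 := (c.continuous_graphParam.tendsto 0).comp hline
      rw [c.graphParam_zero] at h2
      filter_upwards [h2 (Metric.ball_mem_nhds x hr),
        hline (Metric.ball_mem_nhds 0 c.R_pos)] with h h3 h4
      exact ⟨c.mapsTo _ h4, h3⟩
    -- Invariance of `p` along `e` makes the curvature correction invisible.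
    have hpH : ∀ h : ℝ, p (graphParam x ν e f (h • w)) = p (x + h • (w : _)) := by
      intro h
      rw [graphParam, hpe]
      rfl
    rcases lt_or_gt_of_ne hw with hw | hw
    · filter_upwards [hball, eventually_neg_of_deriv_neg (v := (w : EuclideanSpace ℝ (Fin n))) hp hpx
        (by simpa using hw)] with h h1 h2
      rw [hS _ h1, hpH]
      exact iff_of_false (by linarith) (by linarith)
    · filter_upwards [hball, eventually_neg_of_deriv_neg (f := fun y => -p y)
        (v := (w : EuclideanSpace ℝ (Fin n))) hp.neg
        (by simp [hpx]) (by rw [fderiv_fun_neg]; simpa using hw)] with h h1 h2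
      rw [hS _ h1, hpH]
      exact iff_of_true (by linarith) hw

end ChartConsequences

/-! ### Splitting of the integrand and pointwise kernel bounds. -/

section Kernel

variable {n : ℕ}

lemma inner_heatKernelGrad (z ν : EuclideanSpace ℝ (Fin n)) (s : ℝ) :
    inner ℝ (heatKernelGrad z s) ν = -(inner ℝ z ν * heatWeight n (‖z‖ ^ 2) s) := by
  have h1 : HasFDerivAt (fun z : EuclideanSpace ℝ (Fin n) => -‖z‖ ^ 2 / (4 * s))
      ((4 * s)⁻¹ • -((2 : ℝ) • innerSL ℝ z)) z := by
    have h2 : HasFDerivAt (fun z : EuclideanSpace ℝ (Fin n) => ‖z‖ ^ 2) ((2 : ℝ) • innerSL ℝ z) z := by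
      simpa [two_smul] using (hasStrictFDerivAt_norm_sq z).hasFDerivAt
    have h3 := h2.neg.const_smul (4 * s)⁻¹
    refine h3.congr_of_eventuallyEq (Eventually.of_forall fun z => ?_)
    simp only [Pi.smul_apply, Pi.neg_apply, smul_eq_mul]
    ring
  have h4 := (h1.exp.const_mul (1 / (4 * Real.pi * s) ^ ((n : ℝ) / 2))).fderiv
  rw [heatKernelGrad, inner_gradient_eq]
  unfold heatKernel
  rw [h4]
  simp only [_root_.smul_apply, _root_.neg_apply, innerSL_apply_apply,
    smul_eq_mul, heatWeight, mul_inv]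
  ring

lemma potentialIntegrand_eq {x ν : EuclideanSpace ℝ (Fin n)} (hν : ‖ν‖ = 1)
    (φ : EuclideanSpace ℝ (Fin n) × ℝ → ℝ) (t h : ℝ) (p : EuclideanSpace ℝ (Fin n) × ℝ) :
    potentialIntegrand φ ν (x - h • ν) t p
      = h * heatWeight n (‖x - h • ν - p.1‖ ^ 2) (t - p.2) * φ p
        + inner ℝ (p.1 - x) ν * heatWeight n (‖x - h • ν - p.1‖ ^ 2) (t - p.2) * φ p := by
  have h1 : inner ℝ (x - h • ν - p.1) ν = -(h + inner ℝ (p.1 - x) ν) := by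
    rw [show x - h • ν - p.1 = -(p.1 - x) - h • ν by abel, inner_sub_left, inner_neg_left,
      real_inner_smul_left, real_inner_self_eq_norm_sq, hν]
    ring
  rw [potentialIntegrand, inner_heatKernelGrad, h1]
  ring

lemma exists_heatWeight_le (n : ℕ) {δ : ℝ} (hδ : 0 < δ) :
    ∃ C, 0 ≤ C ∧ ∀ q, δ ≤ q → ∀ s, 0 ≤ s → |heatWeight n q s| ≤ C := by
  set m : ℝ := (n : ℝ) / 2 + 1 with hm
  have hm0 : 0 < m := by positivity
  refine ⟨2⁻¹ * (1 / (4 * Real.pi) ^ ((n : ℝ) / 2)) * (m / (δ / 4)) ^ m, by positivity,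
    fun q hq s hs => ?_⟩
  -- At `s = 0` the convention `0⁻¹ = 0` makes the weight vanish.
  rcases hs.eq_or_lt with rfl | hs
  · simp only [heatWeight, mul_zero, inv_zero, zero_mul, abs_zero]
    positivity
  · rw [abs_of_nonneg (heatWeight_nonneg _ _ hs)]
    refine (heatWeight_anti n hs hq).trans ?_
    have h1 := rpow_mul_exp_neg_div_le hm0 (by positivity : 0 < δ / 4) hs
    have h2 : heatWeight n δ s = 2⁻¹ * (1 / (4 * Real.pi) ^ ((n : ℝ) / 2))
        * (1 / s ^ m * Real.exp (-(δ / 4) / s)) := by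
      unfold heatWeight
      rw [Real.mul_rpow (by positivity) hs.le, hm, Real.rpow_add hs, Real.rpow_one,
        show -(δ / 4) / s = -δ / (4 * s) by field_simp]
      have : 0 < (4 * Real.pi) ^ ((n : ℝ) / 2) := by positivity
      have : 0 < s ^ ((n : ℝ) / 2) := by positivity
      field_simp
    rw [h2]
    gcongr

/-- The quadratic smallness of `a` pays for the factor `1/s`: half of the exponent `Q/(8s)` is spent
on `r exp(-r) ≤ 1` with `r = Q/(16s)`, and `Q/(2s) = 8r`. -/
lemma mul_heatWeight_le (n : ℕ) {q Q C a s : ℝ} (hs : 0 < s) (hQ : 0 ≤ Q) (hq : Q / 2 ≤ q)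
    (ha : |a| ≤ C * Q) (hC : 0 ≤ C) :
    |a * heatWeight n q s|
      ≤ 8 * C * (1 / (4 * Real.pi * s) ^ ((n : ℝ) / 2) * Real.exp (-Q / (16 * s))) := by
  rw [abs_mul, abs_of_nonneg (heatWeight_nonneg _ _ hs)]
  have h1 : heatWeight n q s ≤ heatWeight n (Q / 2) s := heatWeight_anti n hs hq
  have h2 : Q / (16 * s) * Real.exp (-Q / (16 * s)) ≤ 1 := by
    have h3 : Q / (16 * s) ≤ Real.exp (Q / (16 * s)) := by
      linarith [Real.add_one_le_exp (Q / (16 * s))]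
    rw [neg_div, Real.exp_neg, ← div_eq_mul_inv, div_le_one (Real.exp_pos _)]
    exact h3
  have h4 : Real.exp (-(Q / 2) / (4 * s)) = Real.exp (-Q / (16 * s)) * Real.exp (-Q / (16 * s)) := by
    rw [← Real.exp_add]
    congr 1
    field_simp
    ring
  calc |a| * heatWeight n q s ≤ (C * Q) * heatWeight n (Q / 2) s :=
        mul_le_mul ha h1 (heatWeight_nonneg _ _ hs) (by positivity)
    _ = 8 * C * (1 / (4 * Real.pi * s) ^ ((n : ℝ) / 2) * Real.exp (-Q / (16 * s)))
        * (Q / (16 * s) * Real.exp (-Q / (16 * s))) := by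
      unfold heatWeight
      rw [h4]
      field_simp
      ring
    _ ≤ 8 * C * (1 / (4 * Real.pi * s) ^ ((n : ℝ) / 2) * Real.exp (-Q / (16 * s))) * 1 := by
      gcongr
    _ = _ := mul_one _

/-- On expanding the square, the cross term is at least `-2hC|y-x|²`, and `h ≤ 1/(4C)` lets half of
`|y-x|²` absorb it. -/
lemma half_sq_add_sq_le {x ν y : EuclideanSpace ℝ (Fin n)} (hν : ‖ν‖ = 1) {C h : ℝ} (hC : 0 < C)
    (hh : 0 ≤ h) (hh' : h ≤ 1 / (4 * C)) (hy : |inner ℝ (y - x) ν| ≤ C * ‖y - x‖ ^ 2) :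
    ‖y - x‖ ^ 2 / 2 + h ^ 2 ≤ ‖x - h • ν - y‖ ^ 2 := by
  have h1 : ‖x - h • ν - y‖ ^ 2 = ‖y - x‖ ^ 2 + 2 * h * inner ℝ (y - x) ν + h ^ 2 := by
    rw [show x - h • ν - y = -((y - x) + h • ν) by abel, norm_neg, norm_add_sq_real,
      real_inner_smul_right, norm_smul, hν, mul_one, Real.norm_eq_abs, sq_abs]
    ring
  have h2 : -(C * ‖y - x‖ ^ 2) ≤ inner ℝ (y - x) ν := (abs_le.1 hy).1
  have h3 : h * (C * ‖y - x‖ ^ 2) ≤ 1 / (4 * C) * (C * ‖y - x‖ ^ 2) := by gcongr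
  have h4 : 1 / (4 * C) * (C * ‖y - x‖ ^ 2) = ‖y - x‖ ^ 2 / 4 := by field_simp
  have h5 := mul_le_mul_of_nonneg_left h2 hh
  rw [h1]
  linarith

end Kernel

/-! ### Bounds and limits of uniformly continuous densities. -/

section Extension

lemma UniformContinuousOn.exists_bound {α : Type*} [PseudoMetricSpace α] {φ : α → ℝ} {s : Set α}
    (hφ : UniformContinuousOn φ s) (hs : TotallyBounded s) : ∃ M, ∀ y ∈ s, |φ y| ≤ M := by
  obtain ⟨δ, hδ, h⟩ := Metric.uniformContinuousOn_iff.1 hφ 1 one_pos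
  obtain ⟨F, hFs, hFfin, hcov⟩ := Metric.finite_approx_of_totallyBounded hs δ hδ
  obtain ⟨B, hB⟩ := (hFfin.image (fun y => |φ y|)).bddAbove
  refine ⟨B + 1, fun y hy => ?_⟩
  obtain ⟨z, hz, hyz⟩ := mem_iUnion₂.1 (hcov hy)
  have h1 := h y hy z (hFs hz) hyz
  rw [Real.dist_eq] at h1
  have h2 : |φ z| ≤ B := hB (mem_image_of_mem _ hz)
  have h3 : |φ y| ≤ |φ y - φ z| + |φ z| := by
    simpa using abs_add_le (φ y - φ z) (φ z)
  linarith

lemma UniformContinuousOn.tendsto_extendFrom {α : Type*} [UniformSpace α] {φ : α → ℝ} {s : Set α}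
    (hφ : UniformContinuousOn φ s) {p : α} (hp : p ∈ closure s) :
    Tendsto φ (𝓝[s] p) (𝓝 (extendFrom s φ p)) := by
  have : (𝓝[s] p).NeBot := mem_closure_iff_nhdsWithin_neBot.1 hp
  have hc : Cauchy (𝓝[s] p) := cauchy_nhds.mono nhdsWithin_le_nhds
  exact _root_.tendsto_extendFrom
    (cauchy_map_iff_exists_tendsto.1 (hc.map_of_le hφ inf_le_right))

end Extension

/-! ### Residual term, and layer term away from the point. -/

section Limits

variable {n : ℕ}

/-- The part `h (2s)⁻¹ Φ ψ` of the potential integrand at `x - h ν`, where `s = t - τ`. -/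
noncomputable def layerIntegrand (ψ : EuclideanSpace ℝ (Fin n) × ℝ → ℝ)
    (ν x : EuclideanSpace ℝ (Fin n)) (t h : ℝ) (p : EuclideanSpace ℝ (Fin n) × ℝ) : ℝ :=
  h * heatWeight n (‖x - h • ν - p.1‖ ^ 2) (t - p.2) * ψ p

/-- The part `⟨y - x, ν⟩ (2s)⁻¹ Φ ψ` of the potential integrand at `x - h ν`, where
`s = t - τ`. -/
noncomputable def residualIntegrand (ψ : EuclideanSpace ℝ (Fin n) × ℝ → ℝ)
    (ν x : EuclideanSpace ℝ (Fin n)) (t h : ℝ) (p : EuclideanSpace ℝ (Fin n) × ℝ) : ℝ :=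
  inner ℝ (p.1 - x) ν * heatWeight n (‖x - h • ν - p.1‖ ^ 2) (t - p.2) * ψ p

/-- The product of the surface measure on `F` and of Lebesgue measure on `(0,t]`. -/
noncomputable abbrev lateralMeasure (F : Set (EuclideanSpace ℝ (Fin n))) (t : ℝ) :
    Measure (EuclideanSpace ℝ (Fin n) × ℝ) :=
  ((μHE[n - 1] : Measure (EuclideanSpace ℝ (Fin n))).restrict F).prod
    ((volume : Measure ℝ).restrict (Ioc 0 t))

lemma measurable_heatWeight_comp (ν x : EuclideanSpace ℝ (Fin n)) (t h : ℝ) :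
    Measurable (fun p : EuclideanSpace ℝ (Fin n) × ℝ =>
      heatWeight n (‖x - h • ν - p.1‖ ^ 2) (t - p.2)) := by
  have : Measurable (fun p : EuclideanSpace ℝ (Fin n) × ℝ =>
      (‖x - h • ν - p.1‖ ^ 2, t - p.2)) := by fun_prop
  exact (measurable_heatWeight n).comp this

lemma measurable_layerIntegrand {ψ : EuclideanSpace ℝ (Fin n) × ℝ → ℝ} (hψ : Measurable ψ)
    (ν x : EuclideanSpace ℝ (Fin n)) (t h : ℝ) : Measurable (layerIntegrand ψ ν x t h) :=
  ((measurable_heatWeight_comp ν x t h).const_mul h).mul hψ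

lemma measurable_residualIntegrand {ψ : EuclideanSpace ℝ (Fin n) × ℝ → ℝ} (hψ : Measurable ψ)
    (ν x : EuclideanSpace ℝ (Fin n)) (t h : ℝ) : Measurable (residualIntegrand ψ ν x t h) := by
  have h1 : Measurable (fun p : EuclideanSpace ℝ (Fin n) × ℝ => inner ℝ (p.1 - x) ν) :=
    Measurable.inner_const (by fun_prop)
  exact (h1.mul (measurable_heatWeight_comp ν x t h)).mul hψ

lemma ae_restrict_Ioc_mem_Ioo (t : ℝ) :
    ∀ᵐ τ ∂((volume : Measure ℝ).restrict (Ioc 0 t)), τ ∈ Ioo 0 t := by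
  rw [Measure.restrict_congr_set (Ioo_ae_eq_Ioc (μ := (volume : Measure ℝ))).symm]
  exact ae_restrict_mem measurableSet_Ioo

lemma ae_lateralMeasure {F : Set (EuclideanSpace ℝ (Fin n))} (hF : MeasurableSet F) (t : ℝ) :
    ∀ᵐ p ∂(lateralMeasure F t), p.1 ∈ F ∧ 0 < p.2 ∧ p.2 < t := by
  have h1 : ∀ᵐ p ∂(lateralMeasure F t), p.1 ∈ F :=
    Measure.quasiMeasurePreserving_fst.ae (ae_restrict_mem hF)
  have h3 : ∀ᵐ p ∂(lateralMeasure F t), p.2 ∈ Ioo 0 t :=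
    Measure.quasiMeasurePreserving_snd.ae (ae_restrict_Ioc_mem_Ioo t)
  filter_upwards [h1, h3] with p a b using ⟨a, b.1, b.2⟩

variable {F : Set (EuclideanSpace ℝ (Fin n))} {x ν e : EuclideanSpace ℝ (Fin n)}
  {f : EuclideanSpace ℝ (Fin n) → ℝ} {K R : ℝ} {θ : (ℝ ∙ ν)ᗮ → NNReal}

/-- Integrating over the surface first gains `s^((n-1)/2)` against `s^(-n/2)`, leaving the
integrable singularity `s^(-1/2)` with `s = t - τ`. -/
lemma integrable_residual_dominator (hn : 2 ≤ n) (c : IsSurfaceChart F x ν e f K R θ)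
    (hF : MeasurableSet F) (hfin : μHE[n - 1] F < ⊤) {t : ℝ} (ht : 0 < t) :
    Integrable (fun p : EuclideanSpace ℝ (Fin n) × ℝ =>
      1 / (4 * Real.pi * (t - p.2)) ^ ((n : ℝ) / 2)
        * Real.exp (-‖p.1 - x‖ ^ 2 / (16 * (t - p.2)))) (lateralMeasure F t) := by
  have : IsFiniteMeasure ((μHE[n - 1] : Measure (EuclideanSpace ℝ (Fin n))).restrict F) :=
    ⟨by rwa [Measure.restrict_apply_univ]⟩
  obtain ⟨C, hC, hle⟩ := c.exists_integral_exp_le hn hF hfin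
  have hm : Measurable (fun p : EuclideanSpace ℝ (Fin n) × ℝ =>
      1 / (4 * Real.pi * (t - p.2)) ^ ((n : ℝ) / 2)
        * Real.exp (-‖p.1 - x‖ ^ 2 / (16 * (t - p.2)))) := by fun_prop
  have hIoo := ae_restrict_Ioc_mem_Ioo t
  have hexp : ∀ s, 0 < s → Integrable (fun y : EuclideanSpace ℝ (Fin n) =>
      Real.exp (-‖y - x‖ ^ 2 / (16 * s)))
      ((μHE[n - 1] : Measure (EuclideanSpace ℝ (Fin n))).restrict F) := by
    intro s hs
    refine Integrable.of_bound (Measurable.aestronglyMeasurable (by fun_prop)) 1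
      (Eventually.of_forall fun y => ?_)
    rw [Real.norm_of_nonneg (Real.exp_pos _).le, Real.exp_le_one_iff, neg_div]
    have : 0 ≤ ‖y - x‖ ^ 2 / (16 * s) := by positivity
    linarith
  rw [integrable_prod_iff' hm.aestronglyMeasurable]
  constructor
  · filter_upwards [hIoo] with τ hτ
    exact (hexp _ (by linarith [hτ.2])).const_mul _
  · have hdom : Integrable (fun τ : ℝ => (1 / (4 * Real.pi) ^ ((n : ℝ) / 2) * C)
        * (t - τ) ^ (-(1 / 2) : ℝ)) ((volume : Measure ℝ).restrict (Ioc 0 t)) := by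
      have h1 := (intervalIntegral.intervalIntegrable_rpow' (a := t) (b := 0)
        (r := -(1 / 2)) (by norm_num)).comp_sub_left t
      rw [sub_self, sub_zero, intervalIntegrable_iff_integrableOn_Ioc_of_le ht.le] at h1
      exact h1.const_mul _
    refine hdom.mono' ?_ ?_
    · exact hm.norm.stronglyMeasurable.integral_prod_left'.aestronglyMeasurable
    · filter_upwards [hIoo] with τ hτ
      have hs : 0 < t - τ := by linarith [hτ.2]
      have hnn : ∀ y : EuclideanSpace ℝ (Fin n), 0 ≤ 1 / (4 * Real.pi * (t - τ)) ^ ((n : ℝ) / 2)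
          * Real.exp (-‖y - x‖ ^ 2 / (16 * (t - τ))) := fun y => by positivity
      simp only [Real.norm_of_nonneg (hnn _)]
      rw [Real.norm_of_nonneg (integral_nonneg hnn), integral_const_mul]
      calc _ ≤ 1 / (4 * Real.pi * (t - τ)) ^ ((n : ℝ) / 2)
            * (C * (t - τ) ^ (((n - 1 : ℕ) : ℝ) / 2)) := by
              gcongr
              exact hle _ hs
        _ = _ := by
          rw [Real.mul_rpow (by positivity) hs.le, Nat.cast_sub (by omega), Nat.cast_one]
          have h1 : (t - τ) ^ (((n : ℝ) - 1) / 2)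
              = (t - τ) ^ ((n : ℝ) / 2) * (t - τ) ^ (-(1 / 2) : ℝ) := by
            rw [← Real.rpow_add hs]
            congr 1
            ring
          rw [h1]
          have : 0 < (t - τ) ^ ((n : ℝ) / 2) := by positivity
          field_simp

/-- The residual part of the potential is absolutely convergent and continuous up to the
boundary. -/
lemma tendsto_integral_residual (hn : 2 ≤ n) (c : IsSurfaceChart F x ν e f K R θ)
    (hF : MeasurableSet F) (hfin : μHE[n - 1] F < ⊤) {ψ : EuclideanSpace ℝ (Fin n) × ℝ → ℝ}
    (hψ : Measurable ψ) {M : ℝ} (hM : ∀ p, |ψ p| ≤ M) {t : ℝ} (ht : 0 < t) :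
    Integrable (residualIntegrand ψ ν x t 0) (lateralMeasure F t) ∧
    (∀ᶠ h in 𝓝[>] (0 : ℝ), Integrable (residualIntegrand ψ ν x t h) (lateralMeasure F t)) ∧
    Tendsto (fun h => ∫ p, residualIntegrand ψ ν x t h p ∂(lateralMeasure F t)) (𝓝[>] 0)
      (𝓝 (∫ p, residualIntegrand ψ ν x t 0 p ∂(lateralMeasure F t))) := by
  obtain ⟨C, hC, hCF⟩ := c.exists_abs_inner_le
  set D : EuclideanSpace ℝ (Fin n) × ℝ → ℝ := fun p =>
    8 * C * (1 / (4 * Real.pi * (t - p.2)) ^ ((n : ℝ) / 2)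
        * Real.exp (-‖p.1 - x‖ ^ 2 / (16 * (t - p.2)))) * M with hD
  have hDint : Integrable D (lateralMeasure F t) :=
    ((integrable_residual_dominator hn c hF hfin ht).const_mul _).mul_const _
  -- The closed interval includes `h = 0`, so the same bound yields convergence of the integral at
  -- the boundary point itself.
  have hbound : ∀ h ∈ Icc 0 (1 / (4 * C)), ∀ᵐ p ∂(lateralMeasure F t),
      ‖residualIntegrand ψ ν x t h p‖ ≤ D p := by
    intro h hh
    filter_upwards [ae_lateralMeasure hF t] with p hp
    have hs : 0 < t - p.2 := by linarith [hp.2.2]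
    have h1 := half_sq_add_sq_le c.norm_normal hC hh.1 hh.2 (hCF _ hp.1)
    have h2 := mul_heatWeight_le n (q := ‖x - h • ν - p.1‖ ^ 2) hs (sq_nonneg ‖p.1 - x‖)
      (by nlinarith [sq_nonneg h]) (hCF _ hp.1) hC.le
    rw [residualIntegrand, norm_mul, Real.norm_eq_abs, Real.norm_eq_abs]
    exact mul_le_mul h2 (hM p) (abs_nonneg _) (by positivity)
  have hint : ∀ h ∈ Icc 0 (1 / (4 * C)),
      Integrable (residualIntegrand ψ ν x t h) (lateralMeasure F t) := fun h hh =>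
    hDint.mono' (measurable_residualIntegrand hψ ν x t h).aestronglyMeasurable (hbound h hh)
  have hev : ∀ᶠ h in 𝓝[>] (0 : ℝ), h ∈ Icc 0 (1 / (4 * C)) :=
    Icc_mem_nhdsGT (by positivity)
  refine ⟨hint 0 ⟨le_rfl, by positivity⟩, hev.mono hint, ?_⟩
  refine tendsto_integral_filter_of_dominated_convergence D
    (Eventually.of_forall fun h => (measurable_residualIntegrand hψ ν x t h).aestronglyMeasurable)
    (hev.mono hbound) hDint (Eventually.of_forall fun p => ?_)
  have hc : Continuous (fun h : ℝ => residualIntegrand ψ ν x t h p) := by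
    unfold residualIntegrand heatWeight
    fun_prop
  exact (hc.tendsto 0).mono_left nhdsWithin_le_nhds

/-- For fixed small `h > 0` the point `x - hν` is at distance at least `h` from `F`, so the weight
is bounded on a finite measure space. -/
lemma eventually_integrable_layer (c : IsSurfaceChart F x ν e f K R θ)
    (hF : MeasurableSet F) (hfin : μHE[n - 1] F < ⊤) {ψ : EuclideanSpace ℝ (Fin n) × ℝ → ℝ}
    (hψ : Measurable ψ) {M : ℝ} (hM : ∀ p, |ψ p| ≤ M) (t : ℝ) :
    ∀ᶠ h in 𝓝[>] (0 : ℝ), Integrable (layerIntegrand ψ ν x t h) (lateralMeasure F t) := by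
  have : IsFiniteMeasure ((μHE[n - 1] : Measure (EuclideanSpace ℝ (Fin n))).restrict F) :=
    ⟨by rwa [Measure.restrict_apply_univ]⟩
  obtain ⟨C, hC, hCF⟩ := c.exists_abs_inner_le
  filter_upwards [Ioc_mem_nhdsGT (by positivity : 0 < 1 / (4 * C))] with h hh
  have hh0 : 0 < h := hh.1
  obtain ⟨B, hB0, hB⟩ := exists_heatWeight_le n (by positivity : 0 < h ^ 2)
  refine Integrable.of_bound (measurable_layerIntegrand hψ ν x t h).aestronglyMeasurable
    (h * B * M) ?_
  filter_upwards [ae_lateralMeasure hF t] with p hp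
  have h1 := half_sq_add_sq_le c.norm_normal hC hh0.le hh.2 (hCF _ hp.1)
  have h2 := hB (‖x - h • ν - p.1‖ ^ 2) (by nlinarith [sq_nonneg ‖p.1 - x‖]) (t - p.2)
    (by linarith [hp.2.2])
  rw [layerIntegrand, norm_mul, norm_mul, Real.norm_of_nonneg hh0.le, Real.norm_eq_abs,
    Real.norm_eq_abs]
  exact mul_le_mul (mul_le_mul_of_nonneg_left h2 hh0.le) (hM p) (abs_nonneg _) (by positivity)

/-- The layer part of the potential over the part of the surface away from `x` is negligible. -/
lemma tendsto_integral_layer_far (c : IsSurfaceChart F x ν e f K R θ)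
    (hF : MeasurableSet F) (hfin : μHE[n - 1] F < ⊤) {ψ : EuclideanSpace ℝ (Fin n) × ℝ → ℝ}
    {M : ℝ} (hM : ∀ p, |ψ p| ≤ M) (t : ℝ) :
    Tendsto (fun h => ∫ p, layerIntegrand ψ ν x t h p
      ∂(lateralMeasure (F \ graphParam x ν e f '' Metric.ball 0 R) t)) (𝓝[>] 0) (𝓝 0) := by
  set A := graphParam x ν e f '' Metric.ball 0 R with hA
  have hfin' : μHE[n - 1] (F \ A) < ⊤ := (measure_mono sdiff_subset).trans_lt hfin
  have : IsFiniteMeasure ((μHE[n - 1] : Measure (EuclideanSpace ℝ (Fin n))).restrict (F \ A)) :=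
    ⟨by rwa [Measure.restrict_apply_univ]⟩
  obtain ⟨C, hC, hCF⟩ := c.exists_abs_inner_le
  obtain ⟨δ, hδ, hfar⟩ := c.exists_far
  obtain ⟨B, hB0, hB⟩ := exists_heatWeight_le n (by positivity : 0 < δ ^ 2 / 2)
  have hlim : Tendsto (fun h : ℝ => h * B * M * (lateralMeasure (F \ A) t).real univ) (𝓝[>] 0)
      (𝓝 0) := by
    have hc : Continuous (fun h : ℝ => h * B * M * (lateralMeasure (F \ A) t).real univ) := by
      fun_prop
    have := hc.tendsto 0
    simp only [zero_mul] at this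
    exact this.mono_left nhdsWithin_le_nhds
  refine squeeze_zero_norm' ?_ hlim
  filter_upwards [Ioc_mem_nhdsGT (by positivity : 0 < 1 / (4 * C))] with h hh
  have hh0 : 0 < h := hh.1
  refine norm_integral_le_of_norm_le_const ?_
  filter_upwards [ae_lateralMeasure (hF.diff c.measurableSet_image) t] with p hp
  have h1 := half_sq_add_sq_le c.norm_normal hC hh0.le hh.2 (hCF _ hp.1.1)
  have h3 : δ ^ 2 ≤ ‖p.1 - x‖ ^ 2 := by
    have := hfar _ hp.1
    gcongr
  have h2 := hB (‖x - h • ν - p.1‖ ^ 2) (by nlinarith [sq_nonneg h]) (t - p.2)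
    (by linarith [hp.2.2])
  rw [layerIntegrand, norm_mul, norm_mul, Real.norm_of_nonneg hh0.le, Real.norm_eq_abs,
    Real.norm_eq_abs]
  exact mul_le_mul (mul_le_mul_of_nonneg_left h2 hh0.le) (hM p) (abs_nonneg _) (by positivity)

end Limits

/-! ### Layer term near the point. -/

section LayerLimit

variable {n : ℕ} {F : Set (EuclideanSpace ℝ (Fin n))} {x ν e : EuclideanSpace ℝ (Fin n)}
  {f : EuclideanSpace ℝ (Fin n) → ℝ} {K R : ℝ} {θ : (ℝ ∙ ν)ᗮ → NNReal}

/-- Puts the layer term in the form needed for the blow-up. The vanishing of `ψ` for `τ ≤ 0` extends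
the range of `s = t - τ` to `(0,∞)`, which parabolic scaling preserves. -/
lemma integral_layer_near (c : IsSurfaceChart F x ν e f K R θ)
    {ψ : EuclideanSpace ℝ (Fin n) × ℝ → ℝ} (hψ : Measurable ψ) {t : ℝ} (ht : 0 < t)
    (hψ0 : ∀ y, ∀ τ ≤ 0, ψ (y, τ) = 0) {h : ℝ}
    (hint : Integrable (layerIntegrand ψ ν x t h)
      (lateralMeasure (graphParam x ν e f '' Metric.ball 0 R) t)) :
    ∫ p, layerIntegrand ψ ν x t h p ∂(lateralMeasure (graphParam x ν e f '' Metric.ball 0 R) t)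
      = ∫ s in Ioi 0, ∫ u, h * heatWeight n (‖x - h • ν - graphParam x ν e f u‖ ^ 2) s
        * (Metric.ball 0 R).indicator (fun u => θ u * ψ (graphParam x ν e f u, t - s)) u := by
  have : IsFiniteMeasure ((μHE[n - 1] : Measure (EuclideanSpace ℝ (Fin n))).restrict
      (graphParam x ν e f '' Metric.ball 0 R)) :=
    ⟨by rw [Measure.restrict_apply_univ]; exact c.measure_image_lt_top⟩
  set J : ℝ → ℝ := fun s => ∫ u, h * heatWeight n (‖x - h • ν - graphParam x ν e f u‖ ^ 2) s
        * (Metric.ball 0 R).indicator (fun u => θ u * ψ (graphParam x ν e f u, t - s)) u with hJ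
  have h1 : ∀ τ, ∫ y in graphParam x ν e f '' Metric.ball 0 R, layerIntegrand ψ ν x t h (y, τ)
      ∂μHE[n - 1] = J (t - τ) := by
    intro τ
    rw [c.setIntegral_image (g := fun y => layerIntegrand ψ ν x t h (y, τ))
      ((measurable_layerIntegrand hψ ν x t h).comp measurable_prodMk_right), hJ,
      ← integral_indicator Metric.isOpen_ball.measurableSet]
    congr 1
    ext u
    by_cases hu : u ∈ Metric.ball 0 R
    · simp only [indicator_of_mem hu, layerIntegrand, sub_sub_cancel]
      ring
    · simp only [indicator_of_notMem hu, mul_zero]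
  rw [lateralMeasure, integral_prod_symm _ hint]
  simp only [h1]
  rw [← intervalIntegral.integral_of_le ht.le, intervalIntegral.integral_comp_sub_left J t, sub_self,
    sub_zero, intervalIntegral.integral_of_le ht.le]
  refine (setIntegral_eq_of_subset_of_forall_sdiff_eq_zero measurableSet_Ioi
    (fun s hs => hs.1) fun s hs => ?_).symm
  have hs' : t < s := by
    by_contra! hcon
    exact hs.2 ⟨hs.1, hcon⟩
  have hz : ∀ u, ψ (graphParam x ν e f u, t - s) = 0 := fun u => hψ0 _ _ (by linarith)
  simp [hJ, hz]

/-- The height of the graph is `O(h²)`, so after division by `h` the difference vector tends to `-(w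
+ ν)` with `w ⟂ ν`. -/
lemma IsSurfaceChart.tendsto_scaled_dist (c : IsSurfaceChart F x ν e f K R θ) (w : (ℝ ∙ ν)ᗮ) :
    Tendsto (fun h : ℝ => ‖x - h • ν - graphParam x ν e f (h • w)‖ ^ 2 / h ^ 2) (𝓝[>] 0)
      (𝓝 (‖w‖ ^ 2 + 1)) := by
  have hline : Tendsto (fun h : ℝ => h • w) (𝓝[>] 0) (𝓝 0) := by
    have : Continuous (fun h : ℝ => h • w) := by fun_prop
    have h1 := this.tendsto 0
    rw [zero_smul] at h1
    exact h1.mono_left nhdsWithin_le_nhds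
  have hball : ∀ᶠ h in 𝓝[>] (0 : ℝ), h • w ∈ Metric.ball 0 R :=
    hline (Metric.ball_mem_nhds 0 c.R_pos)
  have hq : Tendsto (fun h : ℝ => f (x + ((h • w : (ℝ ∙ ν)ᗮ) : EuclideanSpace ℝ (Fin n))) / h)
      (𝓝[>] 0) (𝓝 0) := by
    have hlim : Tendsto (fun h : ℝ => K * h * ‖w‖ ^ 2) (𝓝[>] 0) (𝓝 0) := by
      have : Continuous (fun h : ℝ => K * h * ‖w‖ ^ 2) := by fun_prop
      have h1 := this.tendsto 0
      simp only [mul_zero, zero_mul] at h1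
      exact h1.mono_left nhdsWithin_le_nhds
    refine squeeze_zero_norm' ?_ hlim
    filter_upwards [hball, self_mem_nhdsWithin] with h h1 h2
    have h2 : 0 < h := h2
    have h3 := c.abs_le _ h1
    rw [norm_smul, Real.norm_of_nonneg h2.le] at h3
    rw [norm_div, Real.norm_of_nonneg h2.le, div_le_iff₀ h2, Real.norm_eq_abs]
    calc _ ≤ _ := h3
      _ = _ := by ring
  have hlim : Tendsto (fun h : ℝ => ‖(w : EuclideanSpace ℝ (Fin n)) + ν
      + (f (x + ((h • w : (ℝ ∙ ν)ᗮ) : EuclideanSpace ℝ (Fin n))) / h) • e‖ ^ 2) (𝓝[>] 0)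
      (𝓝 (‖(w : EuclideanSpace ℝ (Fin n)) + ν + (0 : ℝ) • e‖ ^ 2)) :=
    (((hq.smul_const e).const_add _).norm).pow 2
  have hval : ‖(w : EuclideanSpace ℝ (Fin n)) + ν + (0 : ℝ) • e‖ ^ 2 = ‖w‖ ^ 2 + 1 := by
    have h2 : inner ℝ (w : EuclideanSpace ℝ (Fin n)) ν = 0 :=
      Submodule.mem_orthogonal_singleton_iff_inner_left.1 w.2
    rw [zero_smul, add_zero, norm_add_sq_real, h2, c.norm_normal, Submodule.coe_norm]
    ring
  rw [hval] at hlim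
  refine hlim.congr' ?_
  filter_upwards [self_mem_nhdsWithin] with h hh
  have hh : 0 < h := hh
  have h1 : x - h • ν - graphParam x ν e f (h • w)
      = -(h • ((w : EuclideanSpace ℝ (Fin n)) + ν
        + (f (x + ((h • w : (ℝ ∙ ν)ᗮ) : EuclideanSpace ℝ (Fin n))) / h) • e)) := by
    rw [smul_add, smul_add, smul_smul, mul_div_cancel₀ _ hh.ne', graphParam, Submodule.coe_smul]
    abel
  rw [h1, norm_neg, norm_smul, Real.norm_of_nonneg hh.le]
  field_simp

/-- The jump of the layer potential at a relative boundary point of a surface region. -/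
lemma tendsto_integral_layer_near (hn : 1 ≤ n) (c : IsSurfaceChart F x ν e f K R θ)
    (hF : MeasurableSet F) (hfin : μHE[n - 1] F < ⊤) {S : Set (EuclideanSpace ℝ (Fin n))}
    {T t : ℝ} (ht : t ∈ Ioc 0 T) {φ : EuclideanSpace ℝ (Fin n) × ℝ → ℝ}
    (hψ : Measurable ((S ×ˢ Ioc 0 T).indicator φ)) {M : ℝ}
    (hM : ∀ p, |(S ×ˢ Ioc 0 T).indicator φ p| ≤ M) {a : ℝ}
    (hφ : Tendsto φ (𝓝[S ×ˢ Ioc 0 T] (x, t)) (𝓝 a))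
    {ℓ : (ℝ ∙ ν)ᗮ →L[ℝ] ℝ} (hℓ : ℓ ≠ 0) (hS : ∀ w, ℓ w ≠ 0 →
      ∀ᶠ h in 𝓝[>] (0 : ℝ), (graphParam x ν e f (h • w) ∈ S ↔ 0 < ℓ w)) :
    Tendsto (fun h => ∫ p, layerIntegrand ((S ×ˢ Ioc 0 T).indicator φ) ν x t h p
      ∂(lateralMeasure (graphParam x ν e f '' Metric.ball 0 R) t)) (𝓝[>] 0) (𝓝 (a / 4)) := by
  set ψ := (S ×ˢ Ioc 0 T).indicator φ with hψdef
  obtain ⟨C, hC, hCF⟩ := c.exists_abs_inner_le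
  have hM0 : 0 ≤ M := (abs_nonneg _).trans (hM (x, t))
  have hnd : n - 1 + 1 = n := by omega
  have hfr : Fact (Module.finrank ℝ (EuclideanSpace ℝ (Fin n)) = (n - 1) + 1) := ⟨by
    rw [finrank_euclideanSpace_fin, hnd]⟩
  have hν0 : ν ≠ 0 := by
    intro h
    have := c.norm_normal
    simp [h] at this
  have hrank : Module.finrank ℝ (ℝ ∙ ν)ᗮ = n - 1 :=
    Submodule.finrank_orthogonal_span_singleton (𝕜 := ℝ) (n := n - 1) hν0
  set Ψ : (ℝ ∙ ν)ᗮ → ℝ → ℝ := fun u s =>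
    (Metric.ball 0 R).indicator (fun u => (θ u : ℝ) * ψ (graphParam x ν e f u, t - s)) u with hΨ
  have hHm := c.continuous_graphParam.measurable
  have hΨm : Measurable (Function.uncurry Ψ) := by
    have h1 : Measurable (fun p : (ℝ ∙ ν)ᗮ × ℝ => (θ p.1 : ℝ)
        * ψ (graphParam x ν e f p.1, t - p.2)) :=
      (c.measurable_density.comp measurable_fst).coe_nnreal_real.mul
        (hψ.comp ((hHm.comp measurable_fst).prodMk (measurable_snd.const_sub t)))
    have h2 : MeasurableSet {p : (ℝ ∙ ν)ᗮ × ℝ | p.1 ∈ Metric.ball 0 R} :=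
      measurable_fst Metric.isOpen_ball.measurableSet
    exact h1.indicator h2
  -- The constant `1/8` combines `|y-x|²/2` from `half_sq_add_sq_le` with `|y-x|² ≥ |u|²/4`.
  have hlayer := tendsto_integral_layer (d := n - 1) hrank hΨm (M := 2 ^ (n - 1) * M)
    (r := fun h u => ‖x - h • ν - graphParam x ν e f u‖ ^ 2) (h₀ := 1 / (4 * C)) (a := 1 / 8) (c := a)
    ?_ ?_ (by positivity) (by norm_num) ?_ c.tendsto_scaled_dist hℓ ?_
  · rw [hnd] at hlayer
    refine hlayer.congr' ?_
    filter_upwards [eventually_integrable_layer c hF hfin hψ hM t] with h hint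
    refine (integral_layer_near c hψ ht.1 ?_ ?_).symm
    · intro y τ hτ
      exact indicator_of_notMem (fun hmem => absurd hmem.2.1 (not_lt.2 hτ)) _
    · refine hint.mono_measure ?_
      exact Measure.prod_mono (Measure.restrict_mono c.image_subset le_rfl) le_rfl
  · intro u s
    by_cases hu : u ∈ Metric.ball 0 R
    · simp only [hΨ, indicator_of_mem hu, abs_mul, NNReal.abs_eq]
      have h2 : (θ u : ℝ) ≤ 2 ^ (n - 1) := by exact_mod_cast c.density_le u
      exact mul_le_mul h2 (hM _) (abs_nonneg _) (by positivity)
    · simp only [hΨ, indicator_of_notMem hu, abs_zero]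
      positivity
  · intro h
    fun_prop
  · intro h hh u s hne
    have hu : u ∈ Metric.ball 0 R := mem_of_indicator_ne_zero hne
    have h1 := half_sq_add_sq_le c.norm_normal hC hh.1.le hh.2.le (hCF _ (c.mapsTo u hu))
    have h2 := c.half_norm_le hu
    have h3 : (‖u‖ / 2) ^ 2 ≤ ‖graphParam x ν e f u - x‖ ^ 2 := by gcongr
    linarith
  · intro w hw s hs
    have hline : Tendsto (fun h : ℝ => h • w) (𝓝[>] 0) (𝓝 0) := by
      have : Continuous (fun h : ℝ => h • w) := by fun_prop
      have h1 := this.tendsto 0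
      rw [zero_smul] at h1
      exact h1.mono_left nhdsWithin_le_nhds
    have hball : ∀ᶠ h in 𝓝[>] (0 : ℝ), h • w ∈ Metric.ball 0 R :=
      hline (Metric.ball_mem_nhds 0 c.R_pos)
    rcases lt_or_gt_of_ne hw with hneg | hpos
    · rw [indicator_of_notMem (by simpa using hneg.le)]
      refine tendsto_const_nhds.congr' ?_
      filter_upwards [hS w hw] with h hh
      have h1 : graphParam x ν e f (h • w) ∉ S := fun hmem => absurd (hh.1 hmem) (not_lt.2 hneg.le)
      have h2 : ψ (graphParam x ν e f (h • w), t - h ^ 2 * s) = 0 :=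
        indicator_of_notMem (fun hmem => h1 hmem.1) _
      rw [hΨ, eq_comm, indicator_apply_eq_zero]
      intro _
      rw [h2, mul_zero]
    · rw [indicator_of_mem (by simpa using hpos)]
      have htime : Tendsto (fun h : ℝ => t - h ^ 2 * s) (𝓝[>] 0) (𝓝 t) := by
        have : Continuous (fun h : ℝ => t - h ^ 2 * s) := by fun_prop
        have h1 := this.tendsto 0
        simp only [ne_eq, OfNat.ofNat_ne_zero, not_false_eq_true, zero_pow, zero_mul, sub_zero] at h1
        exact h1.mono_left nhdsWithin_le_nhds
      -- The times `t - h²s` approach `t` from below, so the final time `t = T` is covered.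
      have hmem : ∀ᶠ h in 𝓝[>] (0 : ℝ),
          (graphParam x ν e f (h • w), t - h ^ 2 * s) ∈ S ×ˢ Ioc 0 T := by
        filter_upwards [hS w hw, htime (Ioi_mem_nhds ht.1), self_mem_nhdsWithin] with h h1 h2 h3
        refine ⟨h1.2 hpos, h2, ?_⟩
        have : 0 ≤ h ^ 2 * s := by positivity
        have := ht.2
        change t - h ^ 2 * s ≤ T
        linarith
      have hH : Tendsto (fun h : ℝ => graphParam x ν e f (h • w)) (𝓝[>] 0) (𝓝 x) := by
        have h1 := (c.continuous_graphParam.tendsto 0).comp hline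
        rwa [c.graphParam_zero] at h1
      have hlim : Tendsto (fun h : ℝ => φ (graphParam x ν e f (h • w), t - h ^ 2 * s)) (𝓝[>] 0)
          (𝓝 a) :=
        hφ.comp (tendsto_nhdsWithin_iff.2 ⟨hH.prodMk_nhds htime, hmem⟩)
      have hθ : Tendsto (fun h : ℝ => (θ (h • w) : ℝ)) (𝓝[>] 0) (𝓝 1) := by
        have h1 := (NNReal.tendsto_coe.2 c.tendsto_density).comp hline
        rwa [NNReal.coe_one] at h1
      have hprod := hθ.mul hlim
      rw [one_mul] at hprod
      refine hprod.congr' ?_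
      filter_upwards [hball, hmem] with h h1 h2
      have h3 : ψ (graphParam x ν e f (h • w), t - h ^ 2 * s)
          = φ (graphParam x ν e f (h • w), t - h ^ 2 * s) := indicator_of_mem h2 _
      simp only [hΨ, indicator_of_mem h1, h3]

/-- The layer part of the potential tends to a quarter of the boundary value of the density. -/
lemma tendsto_integral_layer_surface (hn : 1 ≤ n) (c : IsSurfaceChart F x ν e f K R θ)
    (hF : MeasurableSet F) (hfin : μHE[n - 1] F < ⊤) {S : Set (EuclideanSpace ℝ (Fin n))}
    {T t : ℝ} (ht : t ∈ Ioc 0 T) {φ : EuclideanSpace ℝ (Fin n) × ℝ → ℝ}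
    (hψ : Measurable ((S ×ˢ Ioc 0 T).indicator φ)) {M : ℝ}
    (hM : ∀ p, |(S ×ˢ Ioc 0 T).indicator φ p| ≤ M) {a : ℝ}
    (hφ : Tendsto φ (𝓝[S ×ˢ Ioc 0 T] (x, t)) (𝓝 a))
    {ℓ : (ℝ ∙ ν)ᗮ →L[ℝ] ℝ} (hℓ : ℓ ≠ 0) (hS : ∀ w, ℓ w ≠ 0 →
      ∀ᶠ h in 𝓝[>] (0 : ℝ), (graphParam x ν e f (h • w) ∈ S ↔ 0 < ℓ w)) :
    Tendsto (fun h => ∫ p, layerIntegrand ((S ×ˢ Ioc 0 T).indicator φ) ν x t h p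
      ∂(lateralMeasure F t)) (𝓝[>] 0) (𝓝 (a / 4)) := by
  have : IsFiniteMeasure ((μHE[n - 1] : Measure (EuclideanSpace ℝ (Fin n))).restrict
      (graphParam x ν e f '' Metric.ball 0 R)) :=
    ⟨by rw [Measure.restrict_apply_univ]; exact c.measure_image_lt_top⟩
  have : IsFiniteMeasure ((μHE[n - 1] : Measure (EuclideanSpace ℝ (Fin n))).restrict
      (F \ graphParam x ν e f '' Metric.ball 0 R)) :=
    ⟨by rw [Measure.restrict_apply_univ]; exact (measure_mono sdiff_subset).trans_lt hfin⟩
  have hlim := (tendsto_integral_layer_far c hF hfin hM t).add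
    (tendsto_integral_layer_near hn c hF hfin ht hψ hM hφ hℓ hS)
  rw [zero_add] at hlim
  have hμ : lateralMeasure F t
      = lateralMeasure (F \ graphParam x ν e f '' Metric.ball 0 R) t
        + lateralMeasure (graphParam x ν e f '' Metric.ball 0 R) t := by
    rw [lateralMeasure, lateralMeasure, lateralMeasure, ← Measure.add_prod]
    congr 1
    rw [← Measure.restrict_union disjoint_sdiff_left c.measurableSet_image,
      sdiff_union_of_subset c.image_subset]
  refine hlim.congr' ?_
  filter_upwards [eventually_integrable_layer c hF hfin hψ hM t] with h hint
  rw [hμ] at hint ⊢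
  rw [integral_add_measure (hint.mono_measure (Measure.le_add_right le_rfl))
    (hint.mono_measure (Measure.le_add_left le_rfl))]

end LayerLimit

/-! ### From the boundary of the domain to charts and integrals. -/

section Surface

variable {n : ℕ}

lemma lateralMeasure_restrict {F S : Set (EuclideanSpace ℝ (Fin n))} (hSF : S ⊆ F)
    (hS : MeasurableSet S) (hfin : μHE[n - 1] F < ⊤) (t : ℝ) :
    (lateralMeasure F t).restrict (S ×ˢ univ) = lateralMeasure S t := by
  have : IsFiniteMeasure ((μHE[n - 1] : Measure (EuclideanSpace ℝ (Fin n))).restrict F) :=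
    ⟨by rwa [Measure.restrict_apply_univ]⟩
  rw [lateralMeasure, ← Measure.prod_restrict, Measure.restrict_restrict hS, inter_eq_left.2 hSF,
    Measure.restrict_univ]

lemma potentialIntegrand_indicator {S : Set (EuclideanSpace ℝ (Fin n))} {T : ℝ}
    (φ : EuclideanSpace ℝ (Fin n) × ℝ → ℝ) (ν z : EuclideanSpace ℝ (Fin n)) (t : ℝ) :
    potentialIntegrand ((S ×ˢ Ioc 0 T).indicator φ) ν z t
      = (S ×ˢ Ioc 0 T).indicator (potentialIntegrand φ ν z t) := by
  ext p
  by_cases hp : p ∈ S ×ˢ Ioc 0 T <;> simp [potentialIntegrand, hp]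

lemma potentialConverges_of_indicator {F S : Set (EuclideanSpace ℝ (Fin n))} (hSF : S ⊆ F)
    (hS : MeasurableSet S) (hfin : μHE[n - 1] F < ⊤) {T t : ℝ} (ht : t ≤ T)
    {φ : EuclideanSpace ℝ (Fin n) × ℝ → ℝ} {ν z : EuclideanSpace ℝ (Fin n)}
    (h : Integrable (potentialIntegrand ((S ×ˢ Ioc 0 T).indicator φ) ν z t)
      (lateralMeasure F t)) : PotentialConverges S φ ν z t := by
  have h1 : Integrable (potentialIntegrand ((S ×ˢ Ioc 0 T).indicator φ) ν z t)
      (lateralMeasure S t) := by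
    rw [← lateralMeasure_restrict hSF hS hfin]
    exact h.restrict
  refine h1.congr ?_
  have : IsFiniteMeasure ((μHE[n - 1] : Measure (EuclideanSpace ℝ (Fin n))).restrict S) :=
    ⟨by rw [Measure.restrict_apply_univ]; exact (measure_mono hSF).trans_lt hfin⟩
  filter_upwards [ae_lateralMeasure hS t] with p hp
  rw [potentialIntegrand_indicator]
  have hmem : p ∈ S ×ˢ Ioc 0 T := ⟨hp.1, hp.2.1, hp.2.2.le.trans ht⟩
  exact indicator_of_mem hmem _

/-- Extending the density by zero replaces the integral over `S` by one over the whole surface `F`,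
to which the chart refers; Fubini then merges the iterated integral. -/
lemma normalDerivPotential_eq_integral {F S : Set (EuclideanSpace ℝ (Fin n))} (hSF : S ⊆ F)
    (hS : MeasurableSet S) (hfin : μHE[n - 1] F < ⊤) {T t : ℝ} (ht : t ∈ Ioc 0 T)
    {φ : EuclideanSpace ℝ (Fin n) × ℝ → ℝ} {ν z : EuclideanSpace ℝ (Fin n)}
    (h : Integrable (potentialIntegrand ((S ×ˢ Ioc 0 T).indicator φ) ν z t)
      (lateralMeasure F t)) :
    normalDerivPotential S φ ν z t
      = ∫ p, potentialIntegrand ((S ×ˢ Ioc 0 T).indicator φ) ν z t p ∂(lateralMeasure F t) := by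
  have : IsFiniteMeasure ((μHE[n - 1] : Measure (EuclideanSpace ℝ (Fin n))).restrict F) :=
    ⟨by rwa [Measure.restrict_apply_univ]⟩
  rw [normalDerivPotential, lateralMeasure, integral_prod_symm _ h,
    intervalIntegral.integral_of_le ht.1.le]
  refine setIntegral_congr_fun measurableSet_Ioc fun τ hτ => ?_
  have hτ' : τ ∈ Ioc 0 T := ⟨hτ.1, hτ.2.trans ht.2⟩
  have h1 : ∀ y, potentialIntegrand ((S ×ˢ Ioc 0 T).indicator φ) ν z t (y, τ)
      = S.indicator (fun y => potentialIntegrand φ ν z t (y, τ)) y := by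
    intro y
    rw [potentialIntegrand_indicator]
    by_cases hy : y ∈ S <;> simp [hy, hτ'.1, hτ'.2]
  simp only [h1]
  rw [integral_indicator hS, Measure.restrict_restrict hS, inter_eq_left.2 hSF]

/-- The boundary is compact, and each chart has finite measure. -/
lemma measure_frontier_lt_top (hn : 1 ≤ n) {Ω : Set (EuclideanSpace ℝ (Fin n))} (hΩ : IsOpen Ω)
    (hΩb : Bornology.IsBounded Ω) (hC2 : HasC2Boundary Ω) : μHE[n - 1] (frontier Ω) < ⊤ := by
  have hcomp : IsCompact (frontier Ω) :=
    Metric.isCompact_of_isClosed_isBounded isClosed_frontier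
      (hΩb.closure.subset frontier_subset_closure)
  refine hcomp.measure_lt_top_of_nhdsWithin fun x hx => ?_
  obtain ⟨r, e, γ, h⟩ := hC2 x hx
  obtain ⟨K, R, θ, c⟩ := exists_isSurfaceChart hn (contDiff_graphFun e h.contDiff) h.norm_axis
    (graphFun_add_smul h.norm_axis γ)
    ((h.mem_frontier_iff hΩ (Metric.mem_ball_self h.radius_pos)).1 hx) rfl h.radius_pos
    (fun y hy => h.mem_frontier_iff hΩ hy)
  exact c.finiteAtFilter

/-- Independence of the normal from the graph chart: the chart that comes with the relative boundary
may differ from the one defining `ν`. -/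
lemma IsExteriorUnitNormal.eq_normalize_gradient {Ω : Set (EuclideanSpace ℝ (Fin n))}
    {x ν e : EuclideanSpace ℝ (Fin n)} {r : ℝ} {γ : EuclideanSpace ℝ (Fin n) → ℝ}
    (hν : IsExteriorUnitNormal Ω x ν) (hΩ : IsOpen Ω) (hx : x ∈ frontier Ω)
    (h : IsC2GraphNear Ω x r e γ) :
    ν = ‖gradient (graphFun e γ) x‖⁻¹ • gradient (graphFun e γ) x := by
  obtain ⟨r', e', γ', h', rfl⟩ := hν
  have key : ∀ {r e γ}, IsC2GraphNear Ω x r e γ → DifferentiableAt ℝ (graphFun e γ) x ∧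
      graphFun e γ x = 0 ∧ gradient (graphFun e γ) x ≠ 0 := by
    intro r e γ h
    have hd := (contDiff_graphFun e h.contDiff).differentiable (by norm_num) x
    refine ⟨hd, (h.mem_frontier_iff hΩ (Metric.mem_ball_self h.radius_pos)).1 hx, fun h0 => ?_⟩
    have h1 := fderiv_axis (e := e) (c := -1) hd
      (by intro y s; rw [graphFun_add_smul h.norm_axis]; ring)
    rw [← inner_gradient_eq, h0, inner_zero_left] at h1
    norm_num at h1
  obtain ⟨a1, a2, a3⟩ := key h'
  obtain ⟨b1, b2, b3⟩ := key h
  refine normalize_gradient_eq a1 b1 a2 b2 a3 b3 ?_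
  filter_upwards [Metric.ball_mem_nhds x h'.radius_pos, Metric.ball_mem_nhds x h.radius_pos]
    with y h1 h2
  rw [← h'.mem_iff y h1, ← h.mem_iff y h2]

/-- A region with `C¹` relative boundary through `x` is asymptotic to a half hyperplane in some
surface chart at `x`. -/
lemma HasC1RelBoundaryAt.exists_chart (hn : 1 ≤ n) {Ω S S' : Set (EuclideanSpace ℝ (Fin n))}
    {x ν : EuclideanSpace ℝ (Fin n)} (hC1 : HasC1RelBoundaryAt Ω S x) (hΩ : IsOpen Ω)
    (hν : IsExteriorUnitNormal Ω x ν) (hx : x ∈ frontier Ω) (hxS : x ∈ closure S)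
    (hxS' : x ∈ closure S') (hS : ∃ U, IsOpen U ∧ S = frontier Ω ∩ U) (hS' : S' ⊆ frontier Ω)
    (hdisj : Disjoint S S') :
    ∃ e f K R θ, IsSurfaceChart (frontier Ω) x ν e f K R θ ∧
      ∃ ℓ : (ℝ ∙ ν)ᗮ →L[ℝ] ℝ, ℓ ≠ 0 ∧ ∀ w, ℓ w ≠ 0 →
        ∀ᶠ h in 𝓝[>] (0 : ℝ), (graphParam x ν e f (h • w) ∈ S ↔ 0 < ℓ w) := by
  obtain ⟨r, e, γ, a, σ, h, ha, hea, hσ, hmem⟩ := hC1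
  obtain ⟨U, hU, hSU⟩ := hS
  obtain ⟨K, R, θ, c⟩ := exists_isSurfaceChart hn (contDiff_graphFun e h.contDiff) h.norm_axis
    (graphFun_add_smul h.norm_axis γ)
    ((h.mem_frontier_iff hΩ (Metric.mem_ball_self h.radius_pos)).1 hx)
    (hν.eq_normalize_gradient hΩ hx h) h.radius_pos (fun y hy => h.mem_frontier_iff hΩ hy)
  refine ⟨e, graphFun e γ, K, R, θ, c, ?_⟩
  set p : EuclideanSpace ℝ (Fin n) → ℝ := fun y =>
    inner ℝ a y - σ (y - inner ℝ e y • e - inner ℝ a y • a) with hp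
  have hpC : ContDiff ℝ 1 p := by
    have h1 : ContDiff ℝ 1 (fun y : EuclideanSpace ℝ (Fin n) => inner ℝ e y) :=
      contDiff_const.inner ℝ contDiff_id
    have h2 : ContDiff ℝ 1 (fun y : EuclideanSpace ℝ (Fin n) => inner ℝ a y) :=
      contDiff_const.inner ℝ contDiff_id
    fun_prop
  have hpd : DifferentiableAt ℝ p x := hpC.differentiable (by norm_num) x
  have hae : inner ℝ a e = 0 := by rw [real_inner_comm]; exact hea
  have hpe : ∀ y, ∀ s : ℝ, p (y + s • e) = p y := by
    intro y s
    have h1 : inner ℝ e (y + s • e) = inner ℝ e y + s := by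
      rw [inner_add_right, inner_smul_right, real_inner_self_eq_norm_sq, h.norm_axis]
      ring
    have h2 : inner ℝ a (y + s • e) = inner ℝ a y := by
      rw [inner_add_right, inner_smul_right, hae, mul_zero, add_zero]
    have h3 : y + s • e - (inner ℝ e y + s) • e - inner ℝ a y • a
        = y - inner ℝ e y • e - inner ℝ a y • a := by
      rw [add_smul]
      abel
    simp only [hp]
    rw [h1, h2, h3]
  have hpa : ∀ y, ∀ s : ℝ, p (y + s • a) = p y + 1 * s := by
    intro y s
    have h1 : inner ℝ a (y + s • a) = inner ℝ a y + s := by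
      rw [inner_add_right, inner_smul_right, real_inner_self_eq_norm_sq, ha]
      ring
    have h2 : inner ℝ e (y + s • a) = inner ℝ e y := by
      rw [inner_add_right, inner_smul_right, hea, mul_zero, add_zero]
    have h3 : y + s • a - inner ℝ e y • e - (inner ℝ a y + s) • a
        = y - inner ℝ e y • e - inner ℝ a y • a := by
      rw [add_smul]
      abel
    simp only [hp]
    rw [h1, h2, h3]
    ring
  have hSp : ∀ y ∈ frontier Ω ∩ Metric.ball x r, y ∈ S ↔ 0 < p y := by
    intro y hy
    rw [hmem y hy, hp, sub_pos]
  have hxmem : x ∈ frontier Ω ∩ Metric.ball x r := ⟨hx, Metric.mem_ball_self h.radius_pos⟩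
  -- `S` is relatively open and `S'` accumulates at `x`, so `x ∈ S` would make them meet.
  have hxnot : x ∉ S := by
    intro hxS
    obtain ⟨y, hyU, hyS'⟩ := mem_closure_iff.1 hxS' U hU (by rw [hSU] at hxS; exact hxS.2)
    exact disjoint_left.1 hdisj (by rw [hSU]; exact ⟨hS' hyS', hyU⟩) hyS'
  -- `x ∉ S` gives `p x ≤ 0`, and `x ∈ closure S` gives `p x ≥ 0`.
  have hpx : p x = 0 := by
    refine le_antisymm (not_lt.1 fun hlt => hxnot ((hSp x hxmem).2 hlt)) ?_
    by_contra! hlt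
    obtain ⟨y, ⟨hy1, hy2⟩, hyS⟩ := mem_closure_iff_nhds.1 hxS _
      (inter_mem (Metric.ball_mem_nhds x h.radius_pos)
        (hpC.continuous.continuousAt.preimage_mem_nhds (Iio_mem_nhds hlt)))
    have hyF : y ∈ frontier Ω := by
      rw [hSU] at hyS
      exact hyS.1
    have h1 := (hSp y ⟨hyF, hy1⟩).1 hyS
    have h2 : p y < 0 := hy2
    linarith
  refine c.exists_halfSpace h.radius_pos hpd hpx hpe ?_ hSp
  intro h0
  have := fderiv_axis hpd hpa
  rw [h0] at this
  norm_num at this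

end Surface

/-! ### The jump relation. -/

theorem theoremA2 {n : ℕ} (hn : 2 ≤ n)
    (Ω : Set (EuclideanSpace ℝ (Fin n))) (hΩ_open : IsOpen Ω)
    (hΩ_bdd : Bornology.IsBounded Ω) (hΩ_C2 : HasC2Boundary Ω)
    (Γ : Fin 2 → Set (EuclideanSpace ℝ (Fin n)))
    (hΓ_open : ∀ i, ∃ U, IsOpen U ∧ Γ i = frontier Ω ∩ U)
    (hΓ_disj : Disjoint (Γ 0) (Γ 1))
    (hΓ_cover : closure (Γ 0) ∪ closure (Γ 1) = frontier Ω)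
    (hΓ_C1 : ∀ i, ∀ x ∈ closure (Γ 0) ∩ closure (Γ 1), HasC1RelBoundaryAt Ω (Γ i) x)
    (T : ℝ) (φ : EuclideanSpace ℝ (Fin n) × ℝ → ℝ) (hφ : MemBT Γ T φ) (i : Fin 2)
    (x : EuclideanSpace ℝ (Fin n)) (hx : x ∈ closure (Γ 0) ∩ closure (Γ 1))
    (ν : EuclideanSpace ℝ (Fin n)) (hν : IsExteriorUnitNormal Ω x ν)
    (t : ℝ) (ht : t ∈ Set.Ioc 0 T) :
    PotentialConverges (Γ i) φ ν x t ∧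
    (∀ᶠ h in 𝓝[>] (0 : ℝ), PotentialConverges (Γ i) φ ν (x - h • ν) t) ∧
    Tendsto (fun h : ℝ => normalDerivPotential (Γ i) φ ν (x - h • ν) t) (𝓝[>] 0)
      (𝓝 (normalDerivPotential (Γ i) φ ν x t
        + 1 / 4 * closureExtension (Γ i) T φ (x, t))) := by
  have hn1 : 1 ≤ n := by omega
  have hsub : ∀ j, Γ j ⊆ frontier Ω := by
    intro j
    obtain ⟨U, -, hU⟩ := hΓ_open j
    rw [hU]
    exact inter_subset_left
  have hxF : x ∈ frontier Ω := hΓ_cover ▸ Or.inl hx.1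
  have hF : MeasurableSet (frontier Ω) := isClosed_frontier.measurableSet
  have hfin := measure_frontier_lt_top hn1 hΩ_open hΩ_bdd hΩ_C2
  have hxcl : ∀ j, x ∈ closure (Γ j) := by
    intro j
    fin_cases j
    · exact hx.1
    · exact hx.2
  have hSm : MeasurableSet (Γ i) := by
    obtain ⟨U, hU, hΓU⟩ := hΓ_open i
    rw [hΓU]
    exact hF.inter hU.measurableSet
  -- In `Fin 2`, `1 - i` is the other index.
  have hdisj : Disjoint (Γ i) (Γ (1 - i)) := by
    fin_cases i
    · exact hΓ_disj
    · exact hΓ_disj.symm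
  obtain ⟨e, f, K, R, θ, c, ℓ, hℓ, hhalf⟩ := (hΓ_C1 i x hx).exists_chart hn1 hΩ_open hν hxF (hxcl i)
    (hxcl (1 - i)) (hΓ_open i) (hsub _) hdisj
  have hφi := hφ i
  have hDm : MeasurableSet (Γ i ×ˢ Ioc 0 T) := hSm.prod measurableSet_Ioc
  -- Nothing is known about `φ` outside the two pieces; the extension by zero is globally measurable
  -- and bounded.
  set ψ := (Γ i ×ˢ Ioc 0 T).indicator φ with hψdef
  have hψ : Measurable ψ := by
    classical
    have := hφi.continuousOn.measurable_piecewise (g := 0) continuousOn_const hDm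
    rwa [piecewise_eq_indicator] at this
  have htb : TotallyBounded (Γ i ×ˢ Ioc 0 T) := by
    have hΓb : Bornology.IsBounded (Γ i) :=
      hΩ_bdd.closure.subset ((hsub i).trans frontier_subset_closure)
    exact (hΓb.prod (Metric.isBounded_Ioc 0 T)).isCompact_closure.totallyBounded.subset
      subset_closure
  obtain ⟨M, hM⟩ := hφi.exists_bound htb
  have hψM : ∀ p, |ψ p| ≤ max M 0 := by
    intro p
    by_cases hp : p ∈ Γ i ×ˢ Ioc 0 T
    · rw [hψdef, indicator_of_mem hp]
      exact (hM p hp).trans (le_max_left _ _)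
    · rw [hψdef, indicator_of_notMem hp, abs_zero]
      exact le_max_right _ _
  have hφlim : Tendsto φ (𝓝[Γ i ×ˢ Ioc 0 T] (x, t)) (𝓝 (closureExtension (Γ i) T φ (x, t))) := by
    refine hφi.tendsto_extendFrom ?_
    rw [closure_prod_eq]
    exact ⟨hxcl i, subset_closure ht⟩
  have hlayer := tendsto_integral_layer_surface hn1 c hF hfin ht hψ hψM hφlim hℓ hhalf
  have hlayer_int := eventually_integrable_layer c hF hfin hψ hψM t
  obtain ⟨hres₀, hres_int, hres⟩ := tendsto_integral_residual hn c hF hfin hψ hψM ht.1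
  have hsplit : ∀ h : ℝ, potentialIntegrand ψ ν (x - h • ν) t
      = fun p => layerIntegrand ψ ν x t h p + residualIntegrand ψ ν x t h p := by
    intro h
    ext p
    exact potentialIntegrand_eq c.norm_normal ψ t h p
  -- At `h = 0` the layer term is identically zero; its nonzero limit is therefore exactly the jump.
  have hzero : potentialIntegrand ψ ν x t = residualIntegrand ψ ν x t 0 := by
    have := hsplit 0
    rw [zero_smul, sub_zero] at this
    rw [this]
    ext p
    simp [layerIntegrand]
  have hint₀ : Integrable (potentialIntegrand ψ ν x t) (lateralMeasure (frontier Ω) t) := by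
    rw [hzero]
    exact hres₀
  have hint : ∀ᶠ h in 𝓝[>] (0 : ℝ),
      Integrable (potentialIntegrand ψ ν (x - h • ν) t) (lateralMeasure (frontier Ω) t) := by
    filter_upwards [hlayer_int, hres_int] with h h1 h2
    rw [hsplit]
    exact h1.add h2
  refine ⟨potentialConverges_of_indicator (hsub i) hSm hfin ht.2 hint₀,
    hint.mono fun h hh => potentialConverges_of_indicator (hsub i) hSm hfin ht.2 hh, ?_⟩
  rw [normalDerivPotential_eq_integral (hsub i) hSm hfin ht hint₀, hzero]
  have hsum := hlayer.add hres
  rw [show closureExtension (Γ i) T φ (x, t) / 4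
      + ∫ p, residualIntegrand ψ ν x t 0 p ∂(lateralMeasure (frontier Ω) t)
      = ∫ p, residualIntegrand ψ ν x t 0 p ∂(lateralMeasure (frontier Ω) t)
        + 1 / 4 * closureExtension (Γ i) T φ (x, t) by ring] at hsum
  refine hsum.congr' ?_
  filter_upwards [hlayer_int, hres_int, hint] with h h1 h2 h3
  rw [normalDerivPotential_eq_integral (hsub i) hSm hfin ht h3, hsplit, integral_add h1 h2]
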